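/- Fix $p\ge 1$ and a compact set $\mathbb{Z}\subset\mathbb{R}$. For every $n$ let $Z_{ij}=Z^{(n)}_{ij}\in\mathbb{Z}^p$ ($1\le i\ne j\le n$) be given covariates, and let $\boldsymbol{\eta}^*=(\alpha_1^*,\dots,\alpha_n^*,\beta_1^*,\dots,\beta_{n-1}^*)\in\mathbb{R}^{2n-1}$ and $\boldsymbol{\gamma}^*\in\mathbb{R}^p$ be the true parameters (both may depend on $n$). For $\boldsymbol\eta=(\alpha_1,\dots,\alpha_n,\beta_1,\dots,\beta_{n-1})$ and $\boldsymbol\gamma\in\mathbb{R}^p$ put $\beta_n=0$, $\pi_{ij}=\alpha_i+\beta_j+Z_{ij}^\top\boldsymbol\gamma$ and $\mu(x)=e^x/(1+e^x)$. Let $(a_{ij})_{i,j\le n}$ be the adjacency matrix of a random directed graph without self-loops ($a_{ii}=0$) in which the $a_{ij}\in\{0,1\}$, $i\neq j$, are independent with $P(a_{ij}=1)=\mu(\pi_{ij}^*)$, where $\pi_{ij}^*$ is $\pi_{ij}$ at $(\boldsymbol\eta^*,\boldsymbol\gamma^*)$. The maximum likelihood estimator (MLE) $(\widehat{\boldsymbol\eta},\widehat{\boldsymbol\gamma})$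 is a maximizer over $\mathbb{R}^{2n-1}\times\mathbb{R}^p$ of $$\ell(\boldsymbol\eta,\boldsymbol\gamma)=\sum_{i\ne j}\bigl[a_{ij}\pi_{ij}-\log(1+e^{\pi_{ij}})\bigr];$$ where no maximizer exists, $(\widehat{\boldsymbol\eta},\widehat{\boldsymbol\gamma})$ is given arbitrary values. Let $u_{ij}=\mu'(\pi_{ij})$ for $i\ne j$, $u_{ii}=0$, $u_{i\cdot}=\sum_j u_{ij}$, $u_{\cdot j}=\sum_i u_{ij}$. Let $V=V(\boldsymbol\eta,\boldsymbol\gamma)$ be the $(2n-1)\times(2n-1)$ Fisher information matrix of $\boldsymbol\eta$: it is symmetric, with $v_{ii}=u_{i\cdot}$ for $i\le n$, $v_{n+j,n+j}=u_{\cdot j}$ for $j\le n-1$, $v_{i,n+j}=v_{n+j,i}=u_{ij}$ for $i\le n$, $j\le n-1$, and all other entries $0$. Its approximate inverse $S=S(\boldsymbol\eta,\boldsymbol\gamma)=(s_{ij})$ is $$s_{ij}=\begin{cases}\delta_{ij}/u_{i\cdot}+1/u_{\cdot n}, & i,j\le n,\\ -1/u_{\cdot n}, & \text{exactly one of } i,j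 \text{ is} \le n,\\ \delta_{ij}/u_{\cdot(j-n)}+1/u_{\cdot n}, & n+1\le i,j\le 2n-1.\end{cases}$$ Let $V_{\gamma\gamma}=\sum_{i\ne j}u_{ij}Z_{ij}Z_{ij}^\top$, let $V_{\eta\gamma}$ be the $(2n-1)\times p$ matrix with rows $\sum_{j}u_{ij}Z_{ij}^\top$ ($i\le n$) followed by $\sum_{i}u_{ij}Z_{ij}^\top$ ($j\le n-1$), and let $H(\boldsymbol\eta,\boldsymbol\gamma)=V_{\gamma\gamma}-V_{\eta\gamma}^\top V^{-1}V_{\eta\gamma}$ be the information matrix of the profiled log-likelihood. Let $B(x,\epsilon)$ be the closed $\ell_\infty$-ball, $z_{\max}=\max_{i\ne j}\|Z_{ij}\|_\infty$, and let $\epsilon_{n1}>0$, $\epsilon_{n1}=o(1)$, and $0<\epsilon_{n2}\le(\log n/n)^{1/2}/(p z_{\max})$. Put $$b_n=\sup_{\boldsymbol\eta\in B(\boldsymbol\eta^*,\epsilon_{n1}),\,\boldsymbol\gamma\in B(\boldsymbol\gamma^*,\epsilon_{n2}),\,i\ne j}\frac{(1+e^{\pi_{ij}})^2}{e^{\pi_{ij}}},$$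 and assume that, for all large $n$ and all $\boldsymbol\eta\in B(\boldsymbol\eta^*,\epsilon_{n1})$, the matrix $H(\boldsymbol\eta,\boldsymbol\gamma^*)$ is positive definite and $\|H(\boldsymbol\eta,\boldsymbol\gamma^*)^{-1}\|_\infty\le\kappa_n/n^2$, where $\|\cdot\|_\infty$ is the maximal absolute row sum. If $\kappa_n b_n^{12}=o(n^{1/2}/\log n)$, then the MLE exists with probability tending to $1$, and for every fixed $k\ge1$ the vector of the first $k$ coordinates of $\widehat{\boldsymbol\eta}-\boldsymbol\eta^*$ is asymptotically multivariate normal with mean $\mathbf 0$ and covariance matrix the upper left $k\times k$ block $S_k$ of $S(\boldsymbol\eta^*,\boldsymbol\gamma^*)$; that is, $S_k$ is positive definite for all large $n$, and as $n\to\infty$, $$S_k^{-1/2}\bigl(\widehat\eta_1-\eta_1^*,\dots,\widehat\eta_k-\eta_k^*\bigr)^\top\ \xrightarrow{\ d\ }\ N(\mathbf 0,I_k).$$ -/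

import Mathlib

open MeasureTheory ProbabilityTheory Filter Topology Asymptotics
open scoped Matrix MatrixOrder

noncomputable section

namespace CovP0

/-- Index set of the free node parameters `(α_1, …, α_n, β_1, …, β_{n-1})`; under the
identification condition, `β_n = 0` is not a free parameter. -/
abbrev Idx (n : ℕ) : Type := Fin n ⊕ Fin (n - 1)

/-- A directed graph on `n` nodes: `a i j = true` iff there is an edge from `i` to `j`. -/
abbrev Adj (n : ℕ) : Type := Fin n → Fin n → Bool

/-- The logistic function `μ(x) = e^x / (1 + e^x)`. -/
def mu (x : ℝ) : ℝ := Real.exp x / (1 + Real.exp x)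

/-- Its derivative `μ'(x) = e^x / (1 + e^x)^2`. -/
def muDeriv (x : ℝ) : ℝ := Real.exp x / (1 + Real.exp x) ^ 2

/-- The outgoingness parameter `α_i`. -/
def alpha {n : ℕ} (η : Idx n → ℝ) (i : Fin n) : ℝ := η (Sum.inl i)

/-- The incomingness parameter `β_j`, with `β_n = 0`. -/
def beta {n : ℕ} (η : Idx n → ℝ) (j : Fin n) : ℝ :=
  if h : (j : ℕ) < n - 1 then η (Sum.inr ⟨j, h⟩) else 0

/-- The linear predictor `π_{ij} = α_i + β_j + Z_{ij}ᵀ γ`. -/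
def linPred {n p : ℕ} (Z : Fin n → Fin n → Fin p → ℝ) (η : Idx n → ℝ) (γ : Fin p → ℝ)
    (i j : Fin n) : ℝ :=
  alpha η i + beta η j + Z i j ⬝ᵥ γ

/-- The log-likelihood of the graph `a`; its terms run over the ordered pairs `i ≠ j`. -/
def logLik {n p : ℕ} (Z : Fin n → Fin n → Fin p → ℝ) (a : Adj n) (η : Idx n → ℝ)
    (γ : Fin p → ℝ) : ℝ :=
  ∑ i, ∑ j ∈ Finset.univ.erase i,
    ((if a i j = true then linPred Z η γ i j else 0)
      - Real.log (1 + Real.exp (linPred Z η γ i j)))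

/-- `(η, γ)` is an (unrestricted) maximum likelihood estimate for the graph `a`. -/
def IsMLE {n p : ℕ} (Z : Fin n → Fin n → Fin p → ℝ) (a : Adj n) (η : Idx n → ℝ)
    (γ : Fin p → ℝ) : Prop :=
  ∀ (η' : Idx n → ℝ) (γ' : Fin p → ℝ), logLik Z a η' γ' ≤ logLik Z a η γ

/-- `A` is a random directed graph without self-loops that follows the model with parameters
`(η, γ)`: the edge indicators are independent Bernoulli variables with success probabilities
`μ(π_{ij})`. -/
structure IsModel {n p : ℕ} {Ω : Type*} [MeasurableSpace Ω] (P : Measure Ω) (A : Ω → Adj n)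
    (Z : Fin n → Fin n → Fin p → ℝ) (η : Idx n → ℝ) (γ : Fin p → ℝ) : Prop where
  measurable : Measurable A
  no_loops : ∀ ω i, A ω i i = false
  indep : iIndepFun
    (fun (q : {q : Fin n × Fin n // q.1 ≠ q.2}) (ω : Ω) => A ω q.1.1 q.1.2) P
  prob : ∀ i j, i ≠ j →
    P {ω | A ω i j = true} = ENNReal.ofReal (mu (linPred Z η γ i j))

/-- `u_{ij} = μ'(π_{ij})` for `i ≠ j`, and `u_{ii} = 0`. -/
def u {n p : ℕ} (Z : Fin n → Fin n → Fin p → ℝ) (η : Idx n → ℝ) (γ : Fin p → ℝ)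
    (i j : Fin n) : ℝ :=
  if i = j then 0 else muDeriv (linPred Z η γ i j)

/-- The row sum `u_{i·}`. -/
def uRow {n p : ℕ} (Z : Fin n → Fin n → Fin p → ℝ) (η : Idx n → ℝ) (γ : Fin p → ℝ)
    (i : Fin n) : ℝ := ∑ j, u Z η γ i j

/-- The column sum `u_{·j}`. -/
def uCol {n p : ℕ} (Z : Fin n → Fin n → Fin p → ℝ) (η : Idx n → ℝ) (γ : Fin p → ℝ)
    (j : Fin n) : ℝ := ∑ i, u Z η γ i j

/-- The column sum `u_{·n}` of the last node. -/
def uLast {n p : ℕ} (Z : Fin n → Fin n → Fin p → ℝ) (η : Idx n → ℝ) (γ : Fin p → ℝ) : ℝ :=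
  if h : 0 < n then uCol Z η γ ⟨n - 1, Nat.sub_lt h Nat.one_pos⟩ else 0

/-- The inclusion of `{1, …, n-1}` into `{1, …, n}`. -/
def incl {n : ℕ} (j : Fin (n - 1)) : Fin n := Fin.castLE (Nat.sub_le n 1) j

/-- The Fisher information matrix `V` of the node parameter, which is also the Jacobian
`∂F/∂η` of the likelihood equations
`F_i = ∑_{k ≠ i} μ(π_{ik}) - d_i`, `F_{n+j} = ∑_{k ≠ j} μ(π_{kj}) - b_j`. -/
def V {n p : ℕ} (Z : Fin n → Fin n → Fin p → ℝ) (η : Idx n → ℝ) (γ : Fin p → ℝ) :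
    Matrix (Idx n) (Idx n) ℝ :=
  Matrix.fromBlocks
    (Matrix.diagonal (uRow Z η γ))
    (Matrix.of fun (i : Fin n) (j : Fin (n - 1)) => u Z η γ i (incl j))
    (Matrix.of fun (j : Fin (n - 1)) (i : Fin n) => u Z η γ i (incl j))
    (Matrix.diagonal fun j : Fin (n - 1) => uCol Z η γ (incl j))

/-- The approximate inverse `S` of `V`. -/
def S {n p : ℕ} (Z : Fin n → Fin n → Fin p → ℝ) (η : Idx n → ℝ) (γ : Fin p → ℝ) :
    Matrix (Idx n) (Idx n) ℝ :=
  Matrix.fromBlocks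
    (Matrix.of fun i j : Fin n => (if i = j then 1 / uRow Z η γ i else 0) + 1 / uLast Z η γ)
    (Matrix.of fun (_ : Fin n) (_ : Fin (n - 1)) => -(1 / uLast Z η γ))
    (Matrix.of fun (_ : Fin (n - 1)) (_ : Fin n) => -(1 / uLast Z η γ))
    (Matrix.of fun i j : Fin (n - 1) =>
      (if i = j then 1 / uCol Z η γ (incl j) else 0) + 1 / uLast Z η γ)

/-- The Jacobian `∂F/∂γ`; its transpose is `∂Q/∂η`, where
`Q = ∑_{i ≠ j} Z_{ij} (μ(π_{ij}) - a_{ij})`. -/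
def Vηγ {n p : ℕ} (Z : Fin n → Fin n → Fin p → ℝ) (η : Idx n → ℝ) (γ : Fin p → ℝ) :
    Matrix (Idx n) (Fin p) ℝ :=
  Matrix.of fun r l =>
    Sum.elim (fun i : Fin n => ∑ j, u Z η γ i j * Z i j l)
      (fun j : Fin (n - 1) => ∑ i, u Z η γ i (incl j) * Z i (incl j) l) r

/-- The Jacobian `∂Q/∂γ`. -/
def Vγγ {n p : ℕ} (Z : Fin n → Fin n → Fin p → ℝ) (η : Idx n → ℝ) (γ : Fin p → ℝ) :
    Matrix (Fin p) (Fin p) ℝ :=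
  Matrix.of fun l m => ∑ i, ∑ j, u Z η γ i j * Z i j l * Z i j m

/-- `H = ∂Q/∂γ - ∂Q/∂η (∂F/∂η)⁻¹ ∂F/∂γ`, the Fisher information matrix of the profiled
log-likelihood. -/
def H {n p : ℕ} (Z : Fin n → Fin n → Fin p → ℝ) (η : Idx n → ℝ) (γ : Fin p → ℝ) :
    Matrix (Fin p) (Fin p) ℝ :=
  Vγγ Z η γ - (Vηγ Z η γ)ᵀ * (V Z η γ)⁻¹ * Vηγ Z η γ

/-- `z_max`, the largest absolute value of a covariate. -/
def zmax {n p : ℕ} (Z : Fin n → Fin n → Fin p → ℝ) : ℝ :=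
  ⨆ q : {q : Fin n × Fin n // q.1 ≠ q.2}, ‖Z q.1.1 q.1.2‖

/-- `b_n`: the supremum of `(1 + e^{π_{ij}})^2 / e^{π_{ij}}` over all pairs `i ≠ j` and all
`(η, γ)` in the closed sup-norm balls of radii `ε₁` and `ε₂` around `(η₀, γ₀)`. -/
def bn {n p : ℕ} (Z : Fin n → Fin n → Fin p → ℝ) (η₀ : Idx n → ℝ) (γ₀ : Fin p → ℝ)
    (ε₁ ε₂ : ℝ) : ℝ :=
  sSup {x : ℝ | ∃ η ∈ Metric.closedBall η₀ ε₁, ∃ γ ∈ Metric.closedBall γ₀ ε₂,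
    ∃ i j : Fin n, i ≠ j ∧
      x = (1 + Real.exp (linPred Z η γ i j)) ^ 2 / Real.exp (linPred Z η γ i j)}

section
attribute [local instance] Matrix.linftyOpNormedAddCommGroup

/-- The matrix norm induced by the sup norm on vectors (the maximal absolute row sum). -/
def infNorm {p : ℕ} (M : Matrix (Fin p) (Fin p) ℝ) : ℝ := ‖M‖

end

/-- The first `k` coordinates of a node parameter (used for `k ≤ n`). -/
def firstCoords {n : ℕ} (k : ℕ) (η : Idx n → ℝ) (i : Fin k) : ℝ :=
  if h : k ≤ n then η (Sum.inl (Fin.castLE h i)) else 0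

/-- The upper left `k × k` block of a matrix (used for `k ≤ n`). -/
def upperLeft {n : ℕ} (k : ℕ) (M : Matrix (Idx n) (Idx n) ℝ) : Matrix (Fin k) (Fin k) ℝ :=
  Matrix.of fun i j =>
    if h : k ≤ n then M (Sum.inl (Fin.castLE h i)) (Sum.inl (Fin.castLE h j)) else 0

/-- The random vectors `X n` in `ℝ^k` are asymptotically normal with mean `0` and covariance
matrices `C n`: eventually `C n` is positive definite, and `(C n)^{-1/2} X n` converges in
distribution to the standard normal law on `ℝ^k`. -/
def AsympNormal {k : ℕ} {Ω : ℕ → Type*} [∀ n, MeasurableSpace (Ω n)]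
    (P : ∀ n, Measure (Ω n)) [∀ n, IsProbabilityMeasure (P n)]
    (X : ∀ n, Ω n → Fin k → ℝ) (C : ℕ → Matrix (Fin k) (Fin k) ℝ) : Prop :=
  (∀ᶠ n in atTop, (C n).PosDef) ∧
  TendstoInDistribution
    (fun n ω => (WithLp.toLp 2 ((CFC.sqrt (C n))⁻¹ *ᵥ X n ω) : EuclideanSpace ℝ (Fin k)))
    atTop id P (stdGaussian (EuclideanSpace ℝ (Fin k)))

end CovP0

end

namespace CovP0

noncomputable section

/-! ### The logistic function -/

/-! Let θ be the deviation of (η, γ) from the truth and J = `info` the full Fisher information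
there. The log-likelihood is concave, so zeros of the score are MLEs, and linearizing the means at
the truth turns the likelihood equations into Jθ = score - remainder(θ). The argument runs in the
sup norm and rests on one estimate for the inverse of J, `Regular.norm_le_of_info_eq`: if Jθ comes
from an array whose row and column sums are at most δ times those of u, and whose covariate sums are
at most Mδn², then ‖θ‖ ≤ Λδ with Λ = 10pM²κB².

For the block V, the equations say that each x_i is, up to δ, minus a weighted average of the y_j,
and conversely. Any two such averages share a definite part of their mass, so oscillations contract
(`two_way_bound`); this bounds the inverse of V linearly in B. The covariate parameter is then
eliminated through the Schur complement H, whose inverse is controlled by κ/n².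

The logistic variance varies by a controlled relative amount, so the remainder is Lipschitz with
entrywise constants proportional to u_ij. Hence the fixed-point map is a contraction on a ball of
radius about B√(log n / n) (`Regular.exists_solution`), and injectivity of J with strict concavity
makes every MLE equal to its fixed point. To first order the deviation is S applied to the score:
the defect consists of weighted averages of independent residuals, which by Hoeffding's inequality
are smaller, by √n up to a power of B, than the individual normalized sums (`Regular.mle_expansion`,
`Regular.measure_bad_le`). After multiplication by √n, all errors are governed by κB⁴ log n / √n,
which tends to 0.

What remains is a linear combination of independent centred Bernoulli variables with weights
O(B/√n). Its characteristic function is compared with the Gaussian one factor by factor; its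
variance is the quadratic form of S_k up to a relative O(B²/n). Lévy's continuity theorem concludes.
-/

lemma muDeriv_pos (x : ℝ) : 0 < muDeriv x := by
  unfold muDeriv; positivity

lemma muDeriv_le (x : ℝ) : muDeriv x ≤ 1 / 4 := by
  unfold muDeriv
  have := Real.exp_pos x
  rw [div_le_div_iff₀ (by positivity) (by norm_num)]
  nlinarith [sq_nonneg (1 - Real.exp x)]

lemma muDeriv_eq (x : ℝ) : muDeriv x = (Real.exp x + 2 + Real.exp (-x))⁻¹ := by
  unfold muDeriv
  rw [Real.exp_neg]
  have := Real.exp_pos x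
  field_simp
  ring

/-- The reciprocal of `muDeriv` is a sum of three terms, each changing by a factor of at most
e^|y-x|. A relative bound, unlike an absolute one, costs no factor B when errors are later compared
with u_ij. -/
lemma muDeriv_le_exp_mul (x y : ℝ) : muDeriv y ≤ Real.exp |y - x| * muDeriv x := by
  rw [muDeriv_eq, muDeriv_eq, ← div_eq_mul_inv, le_div_iff₀ (by positivity),
    inv_mul_le_iff₀ (by positivity)]
  have h1 : Real.exp x ≤ Real.exp y * Real.exp |y - x| := by
    rw [← Real.exp_add]; gcongr; linarith [neg_abs_le (y - x)]
  have h2 : Real.exp (-x) ≤ Real.exp (-y) * Real.exp |y - x| := by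
    rw [← Real.exp_add]; gcongr; linarith [le_abs_self (y - x)]
  have h3 : 1 ≤ Real.exp |y - x| := Real.one_le_exp (abs_nonneg _)
  linarith

lemma abs_muDeriv_sub_le {x y ρ : ℝ} (h : |y - x| ≤ ρ) (hρ : ρ ≤ 1) :
    |muDeriv y - muDeriv x| ≤ 2 * ρ * muDeriv x := by
  have h0 : 0 ≤ |y - x| := abs_nonneg _
  have hx := muDeriv_pos x
  have he : Real.exp |y - x| ≤ 1 + 2 * ρ := by
    have := Real.abs_exp_sub_one_le (x := |y - x|) (by rw [abs_abs]; linarith)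
    rw [abs_abs] at this
    linarith [le_abs_self (Real.exp |y - x| - 1)]
  have h1 := muDeriv_le_exp_mul x y
  have h2 := muDeriv_le_exp_mul y x
  rw [abs_sub_comm] at h2
  have h3 : Real.exp (-|y - x|) * muDeriv x ≤ muDeriv y := by
    rw [Real.exp_neg, inv_mul_le_iff₀ (Real.exp_pos _)]; exact h2
  have h4 := Real.one_sub_le_exp_neg |y - x|
  rw [abs_le]
  constructor <;> nlinarith

lemma hasDerivAt_mu (x : ℝ) : HasDerivAt mu (muDeriv x) x := by
  have h : HasDerivAt (fun x => Real.exp x / (1 + Real.exp x)) _ x :=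
    (Real.hasDerivAt_exp x).div ((Real.hasDerivAt_exp x).const_add 1) (by positivity)
  convert! h using 1
  unfold muDeriv
  ring

/-- The remainder of the linearization of `mu` at `x₀` has a small Lipschitz constant near `x₀`. -/
lemma abs_mu_sub_mu_sub_le {x₀ x y ρ : ℝ} (hx : |x - x₀| ≤ ρ) (hy : |y - x₀| ≤ ρ) (hρ : ρ ≤ 1) :
    |mu x - mu y - muDeriv x₀ * (x - y)| ≤ 2 * ρ * muDeriv x₀ * |x - y| := by
  have key := (convex_Icc (x₀ - ρ) (x₀ + ρ)).norm_image_sub_le_of_norm_hasDerivWithin_le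
    (f := fun z => mu z - muDeriv x₀ * z) (f' := fun z => muDeriv z - muDeriv x₀)
    (C := 2 * ρ * muDeriv x₀) (x := y) (y := x)
    (fun z _ => by
      have := (hasDerivAt_mu z).sub ((hasDerivAt_id z).const_mul (muDeriv x₀))
      simpa using! this.hasDerivWithinAt)
    (fun z hz => abs_muDeriv_sub_le (abs_le.2 ⟨by linarith [hz.1], by linarith [hz.2]⟩) hρ)
    (by rw [abs_le] at hy; constructor <;> linarith)
    (by rw [abs_le] at hx; constructor <;> linarith)
  rw [Real.norm_eq_abs, Real.norm_eq_abs] at key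
  convert key using 2
  ring

lemma mu_pos (x : ℝ) : 0 < mu x := by unfold mu; positivity

lemma mu_lt_one (x : ℝ) : mu x < 1 := by
  unfold mu
  rw [div_lt_one (by positivity)]
  linarith

lemma muDeriv_eq_mu_mul (x : ℝ) : muDeriv x = mu x * (1 - mu x) := by
  unfold mu muDeriv
  have := Real.exp_pos x
  field_simp
  ring

/-- This is the logarithm of strict convexity of exp at the points 0 and y - x with weights 1 - μ(x)
and μ(x). Strictness is what later forces maximizers to have equal predictors. -/
lemma log_one_add_exp_tangent_lt {x y : ℝ} (h : y ≠ x) :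
    Real.log (1 + Real.exp x) + mu x * (y - x) < Real.log (1 + Real.exp y) := by
  have h0 := strictConvexOn_exp.2 (Set.mem_univ 0) (Set.mem_univ (y - x)) (sub_ne_zero.2 h).symm
    (sub_pos.2 (mu_lt_one x)) (mu_pos x) (by ring)
  simp only [smul_eq_mul, mul_zero, zero_add, Real.exp_zero, mul_one] at h0
  have h1 : 1 - mu x + mu x * Real.exp (y - x) = (1 + Real.exp y) / (1 + Real.exp x) := by
    unfold mu
    rw [Real.exp_sub]
    have := Real.exp_pos x
    field_simp
    ring
  rw [h1, ← Real.lt_log_iff_exp_lt (by positivity), Real.log_div (by positivity) (by positivity)]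
    at h0
  linarith

lemma log_one_add_exp_tangent_le (x y : ℝ) :
    Real.log (1 + Real.exp x) + mu x * (y - x) ≤ Real.log (1 + Real.exp y) := by
  rcases eq_or_ne y x with rfl | h
  · simp
  · exact (log_one_add_exp_tangent_lt h).le

/-! ### Oscillation bound for the two-way additive system -/

/-- Two probability vectors that are both at least `c` on `s` give averages that differ by at most
`(1 - c * #s)` times the oscillation. -/
lemma sum_mul_sub_sum_mul_le {ι : Type*} [Fintype ι] [Nonempty ι] {p q y : ι → ℝ} {c R : ℝ}
    (s : Finset ι) (hp : ∀ j, 0 ≤ p j) (hq : ∀ j, 0 ≤ q j) (hp1 : ∑ j, p j = 1)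
    (hq1 : ∑ j, q j = 1) (hps : ∀ j ∈ s, c ≤ p j) (hqs : ∀ j ∈ s, c ≤ q j)
    (hcs : c * s.card ≤ 1) (hy : ∀ j k, y j - y k ≤ R) :
    ∑ j, p j * y j - ∑ j, q j * y j ≤ (1 - c * s.card) * R := by
  obtain ⟨a, ha⟩ := Finite.exists_max y
  obtain ⟨b, hb⟩ := Finite.exists_min y
  -- Averages under p are measured down from the maximum of y and those under q up from its minimum;
  -- on s the two lower bounds add up to a constant.
  have h1 : ∑ j ∈ s, c * (y a - y j) ≤ ∑ j, p j * (y a - y j) :=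
    (Finset.sum_le_sum fun j hj => mul_le_mul_of_nonneg_right (hps j hj)
      (sub_nonneg.2 (ha j))).trans
      (Finset.sum_le_univ_sum_of_nonneg fun j => mul_nonneg (hp j) (sub_nonneg.2 (ha j)))
  have h2 : ∑ j ∈ s, c * (y j - y b) ≤ ∑ j, q j * (y j - y b) :=
    (Finset.sum_le_sum fun j hj => mul_le_mul_of_nonneg_right (hqs j hj)
      (sub_nonneg.2 (hb j))).trans
      (Finset.sum_le_univ_sum_of_nonneg fun j => mul_nonneg (hq j) (sub_nonneg.2 (hb j)))
  have h3 : ∑ j ∈ s, c * (y a - y j) + ∑ j ∈ s, c * (y j - y b) = c * s.card * (y a - y b) := by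
    rw [← Finset.sum_add_distrib, Finset.sum_congr rfl (g := fun _ => c * (y a - y b))
      (fun j _ => by ring), Finset.sum_const, nsmul_eq_mul]
    ring
  simp only [mul_sub, Finset.sum_sub_distrib, ← Finset.sum_mul, hp1, hq1, one_mul] at h1 h2
  simp only [mul_sub, Finset.sum_sub_distrib, ← Finset.sum_mul] at h3
  have h4 : (1 - c * s.card) * (y a - y b) ≤ (1 - c * s.card) * R :=
    mul_le_mul_of_nonneg_left (hy a b) (by linarith)
  linarith

/-- One half of the oscillation bound: from the row equations alone. -/
lemma osc_row_le {n : ℕ} (hn : 4 ≤ n) {w : Fin n → Fin n → ℝ} {m δ R : ℝ} {x y : Fin n → ℝ}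
    (hm : 0 < m) (hw0 : ∀ i j, 0 ≤ w i j) (hw1 : ∀ i j, w i j ≤ 1 / 4)
    (hwm : ∀ i j, i ≠ j → m ≤ w i j)
    (hrow : ∀ i, |∑ j, w i j * (x i + y j)| ≤ δ * ∑ j, w i j)
    (hy : ∀ j k, y j - y k ≤ R) (i k : Fin n) :
    x i - x k ≤ 2 * δ + (1 - 2 * m) * R := by
  have hn' : (4 : ℝ) ≤ n := by exact_mod_cast hn
  have : Nonempty (Fin n) := ⟨i⟩
  have : Nontrivial (Fin n) := Fin.nontrivial_iff_two_le.2 (by omega)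
  have hR : 0 ≤ R := by simpa using hy i i
  have hW : ∀ i, 0 < ∑ j, w i j := fun i => by
    obtain ⟨j, hj⟩ := exists_ne i
    exact Finset.sum_pos' (fun j _ => hw0 i j) ⟨j, Finset.mem_univ _, hm.trans_le (hwm i j hj.symm)⟩
  have hWle : ∀ i, ∑ j, w i j ≤ n / 4 := fun i => by
    refine (Finset.sum_le_sum fun j _ => hw1 i j).trans ?_
    simp; linarith
  have hm4 : m ≤ 1 / 4 := by
    obtain ⟨j, hj⟩ := exists_ne i
    exact (hwm i j hj.symm).trans (hw1 i j)
  have hp1 : ∀ i, ∑ j, w i j / ∑ j, w i j = 1 := fun i => by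
    rw [← Finset.sum_div, div_self (hW i).ne']
  -- A weight of at least m is divided by a row sum of at most n/4.
  have hps : ∀ i j, i ≠ j → 4 * m / n ≤ w i j / ∑ j, w i j := fun i j h => by
    rw [div_le_div_iff₀ (by positivity) (hW i)]
    have h1 := hwm i j h
    have h2 := hWle i
    have h3 := hW i
    nlinarith
  -- The diagonal weights have no positive lower bound, so i and k are removed. As n ≥ 4, the rows i
  -- and k still share mass 4m(n-2)/n ≥ 2m.
  have hcard : ((Finset.univ \ {i, k} : Finset (Fin n)).card : ℝ) ≥ n - 2 := by
    have h1 := Finset.le_card_sdiff ({i, k} : Finset (Fin n)) Finset.univ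
    have h2 : ({i, k} : Finset (Fin n)).card ≤ 2 := Finset.card_le_two
    rw [Finset.card_univ, Fintype.card_fin] at h1
    have : n ≤ (Finset.univ \ {i, k} : Finset (Fin n)).card + 2 := by omega
    have : (n : ℝ) ≤ (Finset.univ \ {i, k} : Finset (Fin n)).card + 2 := by exact_mod_cast this
    linarith
  have hcard' : ((Finset.univ \ {i, k} : Finset (Fin n)).card : ℝ) ≤ n := by
    have := Finset.card_le_univ (Finset.univ \ {i, k} : Finset (Fin n))
    rw [Fintype.card_fin] at this
    exact_mod_cast this
  have hc0 : 0 ≤ 4 * m / n := by positivity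
  have hcn : 4 * m / n * n = 4 * m := by field_simp
  have key := sum_mul_sub_sum_mul_le (p := fun j => w k j / ∑ j, w k j)
    (q := fun j => w i j / ∑ j, w i j) (y := y) (c := 4 * m / n) (R := R) (Finset.univ \ {i, k})
    (fun j => div_nonneg (hw0 k j) (hW k).le) (fun j => div_nonneg (hw0 i j) (hW i).le)
    (hp1 k) (hp1 i)
    (fun j hj => hps k j (by rintro rfl; simp at hj))
    (fun j hj => hps i j (by rintro rfl; simp at hj))
    (by nlinarith) hy
  have hx : ∀ i, |x i + ∑ j, w i j / (∑ j, w i j) * y j| ≤ δ := fun i => by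
    have h1 : x i + ∑ j, w i j / (∑ j, w i j) * y j
        = (∑ j, w i j * (x i + y j)) / ∑ j, w i j := by
      simp only [mul_add, Finset.sum_add_distrib, ← Finset.sum_mul, add_div, div_mul_eq_mul_div,
        ← Finset.sum_div]
      have := (hW i).ne'
      field_simp
    rw [h1, abs_div, abs_of_pos (hW i), div_le_iff₀ (hW i)]
    exact hrow i
  have h1 := abs_le.1 (hx i)
  have h2 := abs_le.1 (hx k)
  have h3 : (1 - 4 * m / n * ((Finset.univ \ {i, k} : Finset (Fin n)).card : ℝ)) * R
      ≤ (1 - 2 * m) * R := by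
    refine mul_le_mul_of_nonneg_right ?_ hR
    have : 4 * m / n * (n - 2) ≥ 2 * m := by
      rw [mul_sub, hcn]
      have : 4 * m / n ≤ m := by
        rw [div_le_iff₀ (by positivity)]; nlinarith
      linarith
    nlinarith
  linarith [h1.2, h2.1]

/-- Sup-norm bound for the solution of the two-way additive system with weights in `[m, 1/4]`. -/
lemma two_way_bound {n : ℕ} (hn : 4 ≤ n) {w : Fin n → Fin n → ℝ} {m δ : ℝ} {x y : Fin n → ℝ}
    (hm : 0 < m) (hw0 : ∀ i j, 0 ≤ w i j) (hw1 : ∀ i j, w i j ≤ 1 / 4)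
    (hwm : ∀ i j, i ≠ j → m ≤ w i j)
    (hrow : ∀ i, |∑ j, w i j * (x i + y j)| ≤ δ * ∑ j, w i j)
    (hcol : ∀ j, |∑ i, w i j * (x i + y j)| ≤ δ * ∑ i, w i j)
    {j₀ : Fin n} (hy₀ : y j₀ = 0) :
    (∀ i, |x i| ≤ 5 / 2 * δ / m) ∧ ∀ j, |y j| ≤ 5 / 2 * δ / m := by
  have : Nonempty (Fin n) := ⟨j₀⟩
  have : Nontrivial (Fin n) := Fin.nontrivial_iff_two_le.2 (by omega)
  obtain ⟨a, ha⟩ := Finite.exists_max x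
  obtain ⟨b, hb⟩ := Finite.exists_min x
  obtain ⟨c, hc⟩ := Finite.exists_max y
  obtain ⟨d, hd⟩ := Finite.exists_min y
  have hxR : ∀ i k, x i - x k ≤ x a - x b := fun i k => by linarith [ha i, hb k]
  have hyR : ∀ i k, y i - y k ≤ y c - y d := fun i k => by linarith [hc i, hd k]
  have h1 := osc_row_le hn hm hw0 hw1 hwm hrow hyR a b
  have h2 := osc_row_le (w := fun i j => w j i) (x := y) (y := x) hn hm (fun i j => hw0 j i)
    (fun i j => hw1 j i) (fun i j h => hwm j i h.symm)
    (fun i => by simpa only [add_comm] using hcol i) hxR c d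
  -- Adding the row and column bounds lets the factor 1 - 2m be absorbed on the left.
  have hsum : 2 * m * ((x a - x b) + (y c - y d)) ≤ 4 * δ := by nlinarith
  have hx0 := hb a
  have hy0 := hd c
  have hm4 : m ≤ 1 / 4 := by
    obtain ⟨j, hj⟩ := exists_ne j₀
    exact (hwm j₀ j hj.symm).trans (hw1 j₀ j)
  have hyb : y c - y d ≤ 2 * δ / m := by
    rw [le_div_iff₀ hm]; nlinarith
  have hδ : 0 ≤ δ := by nlinarith
  have hdm : δ ≤ 1 / 4 * (δ / m) := by
    rw [← mul_div_assoc, le_div_iff₀ hm]; nlinarith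
  -- The normalization at j₀ turns the oscillation bound into a sup bound; without it, (x, y) is
  -- determined only up to a shift (c, -c).
  have hy' : ∀ j, |y j| ≤ 2 * (δ / m) := fun j => by
    rw [abs_le]
    have e1 := hyR j j₀
    have e2 := hyR j₀ j
    rw [mul_div_assoc] at hyb
    constructor <;> linarith
  have hδm : 0 ≤ δ / m := by positivity
  refine ⟨fun i => ?_, fun j => (hy' j).trans (by rw [mul_div_assoc]; linarith)⟩
  have hW : 0 < ∑ j, w i j := by
    obtain ⟨j, hj⟩ := exists_ne i
    exact Finset.sum_pos' (fun j _ => hw0 i j) ⟨j, Finset.mem_univ _, hm.trans_le (hwm i j hj.symm)⟩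
  have h3 : |x i * ∑ j, w i j| ≤ (δ + 2 * (δ / m)) * ∑ j, w i j := by
    have h4 : x i * ∑ j, w i j = ∑ j, w i j * (x i + y j) - ∑ j, w i j * y j := by
      rw [Finset.mul_sum, ← Finset.sum_sub_distrib]
      exact Finset.sum_congr rfl fun j _ => by ring
    rw [h4, add_mul]
    refine (abs_sub _ _).trans (add_le_add (hrow i) ?_)
    refine (Finset.abs_sum_le_sum_abs _ _).trans ?_
    rw [Finset.mul_sum]
    refine Finset.sum_le_sum fun j _ => ?_
    rw [abs_mul, abs_of_nonneg (hw0 i j), mul_comm]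
    exact mul_le_mul_of_nonneg_right (hy' j) (hw0 i j)
  rw [abs_mul, abs_of_pos hW] at h3
  have := le_of_mul_le_mul_right h3 hW
  rw [mul_div_assoc]
  linarith

end

noncomputable section

variable {n p : ℕ}

/-! ### The linear structure of the model -/

/-- The full parameter `(η, γ)`, with the sup norm. -/
abbrev Param (n p : ℕ) : Type := (Idx n → ℝ) × (Fin p → ℝ)

lemma beta_add (η η' : Idx n → ℝ) (j : Fin n) : beta (η + η') j = beta η j + beta η' j := by
  unfold beta; split_ifs <;> simp

lemma beta_smul (c : ℝ) (η : Idx n → ℝ) (j : Fin n) : beta (c • η) j = c * beta η j := by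
  unfold beta; split_ifs <;> simp

lemma beta_last (η : Idx n → ℝ) {j : Fin n} (hj : (j : ℕ) = n - 1) : beta η j = 0 := by
  unfold beta; rw [dif_neg (by omega)]

lemma beta_incl (η : Idx n → ℝ) (j : Fin (n - 1)) : beta η (incl j) = η (Sum.inr j) := by
  unfold beta incl
  rw [dif_pos (by simp)]
  rfl

lemma sum_incl_add_last {i : Fin n} (hi : (i : ℕ) = n - 1) (f : Fin n → ℝ) :
    ∑ j, f j = ∑ j : Fin (n - 1), f (incl j) + f i := by
  obtain ⟨m, rfl⟩ : ∃ m, n = m + 1 := ⟨n - 1, by have := i.2; omega⟩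
  rw [Fin.sum_univ_castSucc]
  congr 2
  ext; simpa using hi.symm

lemma sum_mul_beta (f : Fin n → ℝ) (η : Idx n → ℝ) :
    ∑ j, f j * beta η j = ∑ j : Fin (n - 1), f (incl j) * η (Sum.inr j) := by
  rcases Nat.eq_zero_or_pos n with rfl | hn
  · simp
  · rw [sum_incl_add_last (i := ⟨n - 1, by omega⟩) rfl, beta_last η rfl]
    simp [beta_incl]

/-- The linear predictor as a linear map of the parameter. -/
def lin (Z : Fin n → Fin n → Fin p → ℝ) : Param n p →ₗ[ℝ] Fin n → Fin n → ℝ where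
  toFun θ := linPred Z θ.1 θ.2
  map_add' θ θ' := by
    ext i j
    simp only [linPred, alpha, Prod.fst_add, Prod.snd_add, beta_add, Pi.add_apply, dotProduct_add]
    ring
  map_smul' c θ := by
    ext i j
    simp only [linPred, alpha, Prod.smul_fst, Prod.smul_snd, beta_smul, Pi.smul_apply,
      dotProduct_smul, smul_eq_mul, RingHom.id_apply]
    ring

lemma lin_apply (Z : Fin n → Fin n → Fin p → ℝ) (θ : Param n p) (i j : Fin n) :
    lin Z θ i j = linPred Z θ.1 θ.2 i j := rfl

/-- The transpose of `lin`: the row sums, the column sums (except the last one), and the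
covariate sums of an array. -/
def linT (Z : Fin n → Fin n → Fin p → ℝ) : (Fin n → Fin n → ℝ) →ₗ[ℝ] Param n p where
  toFun w := (Sum.elim (fun i => ∑ j, w i j) (fun j => ∑ i, w i (incl j)),
    fun l => ∑ i, ∑ j, w i j * Z i j l)
  map_add' w w' := by
    ext x
    · rcases x with x | x <;> simp [Finset.sum_add_distrib]
    · simp [Finset.sum_add_distrib, add_mul]
  map_smul' c w := by
    ext x
    · rcases x with x | x <;> simp [Finset.mul_sum]
    · simp [Finset.mul_sum, mul_assoc]

lemma linT_inl (Z : Fin n → Fin n → Fin p → ℝ) (w : Fin n → Fin n → ℝ) (i : Fin n) :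
    (linT Z w).1 (Sum.inl i) = ∑ j, w i j := rfl

lemma linT_inr (Z : Fin n → Fin n → Fin p → ℝ) (w : Fin n → Fin n → ℝ) (j : Fin (n - 1)) :
    (linT Z w).1 (Sum.inr j) = ∑ i, w i (incl j) := rfl

lemma linT_snd (Z : Fin n → Fin n → Fin p → ℝ) (w : Fin n → Fin n → ℝ) (l : Fin p) :
    (linT Z w).2 l = ∑ i, ∑ j, w i j * Z i j l := rfl

/-- The pairing identity that makes `linT` the transpose of `lin`. -/
lemma sum_mul_lin (Z : Fin n → Fin n → Fin p → ℝ) (w : Fin n → Fin n → ℝ) (θ : Param n p) :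
    ∑ i, ∑ j, w i j * lin Z θ i j = (linT Z w).1 ⬝ᵥ θ.1 + (linT Z w).2 ⬝ᵥ θ.2 := by
  have h1 : ∑ i, ∑ j, w i j * beta θ.1 j
      = ∑ j : Fin (n - 1), (∑ i, w i (incl j)) * θ.1 (Sum.inr j) := by
    rw [Finset.sum_comm, ← sum_mul_beta (fun j => ∑ i, w i j)]
    simp only [Finset.sum_mul]
  have h2 : ∑ i, ∑ j, w i j * (Z i j ⬝ᵥ θ.2) = (linT Z w).2 ⬝ᵥ θ.2 := by
    simp only [dotProduct, linT_snd, Finset.mul_sum, Finset.sum_mul]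
    rw [Finset.sum_comm' (t' := Finset.univ) (s' := fun _ => Finset.univ) (by simp)]
    rw [Finset.sum_comm]
    conv_rhs => rw [Finset.sum_comm]
    refine Finset.sum_congr rfl fun i _ => ?_
    rw [Finset.sum_comm]
    refine Finset.sum_congr rfl fun i _ => Finset.sum_congr rfl fun _ _ => by ring
  simp only [lin_apply, linPred, mul_add, Finset.sum_add_distrib, h1, h2]
  simp only [dotProduct, Fintype.sum_sum_type, linT_inl, linT_inr, alpha, Finset.sum_mul]

/-- All row and column sums, the last column included, are determined by `linT`. -/
lemma col_sum_eq_of_linT_fst_eq {Z : Fin n → Fin n → Fin p → ℝ} {w w' : Fin n → Fin n → ℝ}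
    (h : (linT Z w).1 = (linT Z w').1) (j : Fin n) : ∑ i, w i j = ∑ i, w' i j := by
  have hr : ∀ i, ∑ j, w i j = ∑ j, w' i j := fun i => congrFun h (Sum.inl i)
  have hc : ∀ j : Fin (n - 1), ∑ i, w i (incl j) = ∑ i, w' i (incl j) :=
    fun j => congrFun h (Sum.inr j)
  by_cases hj : (j : ℕ) < n - 1
  · exact hc ⟨j, hj⟩
  · have hj' : (j : ℕ) = n - 1 := by have := j.2; omega
    -- Rows and columns have the same grand total, so the last column sum is that total minus the
    -- other column sums.
    have h1 : ∑ j, ∑ i, w i j = ∑ j, ∑ i, w' i j := by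
      rw [Finset.sum_comm, Finset.sum_congr rfl fun i _ => hr i, Finset.sum_comm]
    rw [sum_incl_add_last hj' (fun j => ∑ i, w i j), sum_incl_add_last hj' (fun j => ∑ i, w' i j),
      Finset.sum_congr rfl fun j _ => hc j] at h1
    exact add_left_cancel h1

variable {Z : Fin n → Fin n → Fin p → ℝ} {η₀ : Idx n → ℝ} {γ₀ : Fin p → ℝ}

/-- The full Fisher information at `(η₀, γ₀)` as a linear map. -/
def info (Z : Fin n → Fin n → Fin p → ℝ) (η₀ : Idx n → ℝ) (γ₀ : Fin p → ℝ) :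
    Param n p →ₗ[ℝ] Param n p where
  toFun θ := linT Z (fun i j => u Z η₀ γ₀ i j * lin Z θ i j)
  map_add' θ θ' := by
    rw [← map_add]
    congr 1
    ext i j
    simp only [map_add, Pi.add_apply]
    ring
  map_smul' c θ := by
    rw [RingHom.id_apply, ← map_smul]
    congr 1
    ext i j
    simp only [map_smul, Pi.smul_apply, smul_eq_mul]
    ring

lemma info_apply (θ : Param n p) :
    info Z η₀ γ₀ θ = linT Z (fun i j => u Z η₀ γ₀ i j * lin Z θ i j) := rfl

/-- This and the next lemmas on `info` identify its four blocks with the given matrices, so that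
block elimination applies to the linear map. -/
lemma info_fst_of_eta (η : Idx n → ℝ) : (info Z η₀ γ₀ (η, 0)).1 = V Z η₀ γ₀ *ᵥ η := by
  ext x
  rw [info_apply]
  rcases x with i | j
  · rw [linT_inl]
    simp only [lin_apply, linPred, dotProduct_zero, add_zero, mul_add, Finset.sum_add_distrib,
      sum_mul_beta, ← Finset.sum_mul]
    simp [V, Matrix.mulVec, dotProduct, Fintype.sum_sum_type, Matrix.diagonal_apply, alpha, uRow]
  · rw [linT_inr]
    simp only [lin_apply, linPred, dotProduct_zero, add_zero, mul_add, Finset.sum_add_distrib,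
      ← Finset.sum_mul, beta_incl]
    simp [V, Matrix.mulVec, dotProduct, Fintype.sum_sum_type, Matrix.diagonal_apply, alpha, uCol]

lemma sum_mul_dotProduct {ι : Type*} (s : Finset ι) (c : ι → ℝ) (f : ι → Fin p → ℝ)
    (γ : Fin p → ℝ) :
    ∑ i ∈ s, c i * (f i ⬝ᵥ γ) = ∑ l, (∑ i ∈ s, c i * f i l) * γ l := by
  simp only [dotProduct, Finset.mul_sum, Finset.sum_mul]
  rw [Finset.sum_comm]
  exact Finset.sum_congr rfl fun _ _ => Finset.sum_congr rfl fun _ _ => by ring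

lemma info_fst_of_gamma (γ : Fin p → ℝ) : (info Z η₀ γ₀ (0, γ)).1 = Vηγ Z η₀ γ₀ *ᵥ γ := by
  have hb : ∀ j : Fin n, beta (0 : Idx n → ℝ) j = 0 := fun j => by simp [beta]
  ext x
  rw [info_apply]
  rcases x with i | j
  · rw [linT_inl]
    simp only [lin_apply, linPred, alpha, hb, Pi.zero_apply, zero_add, sum_mul_dotProduct]
    simp [Vηγ, Matrix.mulVec, dotProduct]
  · rw [linT_inr]
    simp only [lin_apply, linPred, alpha, hb, Pi.zero_apply, zero_add, sum_mul_dotProduct]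
    simp [Vηγ, Matrix.mulVec, dotProduct]

lemma info_snd_of_eta (η : Idx n → ℝ) : (info Z η₀ γ₀ (η, 0)).2 = (Vηγ Z η₀ γ₀)ᵀ *ᵥ η := by
  ext l
  rw [info_apply, linT_snd]
  have h := sum_mul_lin Z (fun i j => u Z η₀ γ₀ i j * Z i j l) (η, 0)
  simp only [dotProduct_zero, add_zero] at h
  calc _ = ∑ i, ∑ j, u Z η₀ γ₀ i j * Z i j l * lin Z (η, 0) i j :=
        Finset.sum_congr rfl fun _ _ => Finset.sum_congr rfl fun _ _ => by ring
    _ = _ := by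
      rw [h]
      refine Finset.sum_congr rfl fun x _ => ?_
      rcases x with i | j <;> rfl

lemma info_snd_of_gamma (γ : Fin p → ℝ) : (info Z η₀ γ₀ (0, γ)).2 = Vγγ Z η₀ γ₀ *ᵥ γ := by
  have hb : ∀ j : Fin n, beta (0 : Idx n → ℝ) j = 0 := fun j => by simp [beta]
  ext l
  rw [info_apply, linT_snd]
  simp only [lin_apply, linPred, alpha, hb, Pi.zero_apply, zero_add]
  calc _ = ∑ i, ∑ j, (u Z η₀ γ₀ i j * Z i j l) * (Z i j ⬝ᵥ γ) :=
        Finset.sum_congr rfl fun _ _ => Finset.sum_congr rfl fun _ _ => by ring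
    _ = _ := by
      simp only [sum_mul_dotProduct]
      rw [Finset.sum_comm]
      simp only [← Finset.sum_mul]
      rfl

lemma info_eq (θ : Param n p) :
    info Z η₀ γ₀ θ = (V Z η₀ γ₀ *ᵥ θ.1 + Vηγ Z η₀ γ₀ *ᵥ θ.2,
      (Vηγ Z η₀ γ₀)ᵀ *ᵥ θ.1 + Vγγ Z η₀ γ₀ *ᵥ θ.2) := by
  have h : θ = (θ.1, 0) + (0, θ.2) := by simp
  rw [← info_fst_of_eta, ← info_fst_of_gamma, ← info_snd_of_eta, ← info_snd_of_gamma]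
  conv_lhs => rw [h, map_add]
  rfl

end

noncomputable section

variable {n p : ℕ} {Z : Fin n → Fin n → Fin p → ℝ} {η₀ : Idx n → ℝ} {γ₀ : Fin p → ℝ}

lemma abs_mulVec_le_infNorm (A : Matrix (Fin p) (Fin p) ℝ) (v : Fin p → ℝ) :
    ‖A *ᵥ v‖ ≤ infNorm A * ‖v‖ :=
  Matrix.linfty_opNorm_mulVec A v

/-! ### Sup-norm bound for the inverse Fisher information -/

/-- Quantitative regularity of the model at `(η₀, γ₀)`: the variances are at least `1 / B`, the
covariates are bounded by `M`, and the inverse profile information is at most `κ / n ^ 2`. -/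
structure Regular (Z : Fin n → Fin n → Fin p → ℝ) (η₀ : Idx n → ℝ) (γ₀ : Fin p → ℝ)
    (B M κ : ℝ) : Prop where
  four_le : 4 ≤ n
  p_pos : 1 ≤ p
  B_ge : 4 ≤ B
  M_ge : 1 ≤ M
  u_ge : ∀ i j, i ≠ j → 1 / B ≤ u Z η₀ γ₀ i j
  Z_le : ∀ i j, i ≠ j → ∀ l, |Z i j l| ≤ M
  H_posDef : (H Z η₀ γ₀).PosDef
  H_inv_le : infNorm (H Z η₀ γ₀)⁻¹ ≤ κ / (n : ℝ) ^ 2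

lemma u_nonneg (i j : Fin n) : 0 ≤ u Z η₀ γ₀ i j := by
  unfold u; split_ifs
  · exact le_rfl
  · exact (muDeriv_pos _).le

lemma u_le (i j : Fin n) : u Z η₀ γ₀ i j ≤ 1 / 4 := by
  unfold u; split_ifs
  · norm_num
  · exact muDeriv_le _

lemma u_self (i : Fin n) : u Z η₀ γ₀ i i = 0 := by simp [u]

lemma sum_sum_le_sq {f : Fin n → Fin n → ℝ} {c : ℝ} (h : ∀ i j, |f i j| ≤ c) :
    |∑ i, ∑ j, f i j| ≤ c * (n : ℝ) ^ 2 := by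
  refine (Finset.abs_sum_le_sum_abs _ _).trans ?_
  refine (Finset.sum_le_sum fun i _ => (Finset.abs_sum_le_sum_abs _ _).trans
    (Finset.sum_le_sum fun j _ => h i j)).trans (le_of_eq ?_)
  simp
  ring

lemma abs_dotProduct_le {x y : Fin p → ℝ} {M : ℝ} (hx : ∀ l, |x l| ≤ M) :
    |x ⬝ᵥ y| ≤ p * M * ‖y‖ := by
  refine (Finset.abs_sum_le_sum_abs _ _).trans ?_
  refine (Finset.sum_le_sum (g := fun _ => M * ‖y‖) fun l _ => ?_).trans (le_of_eq ?_)
  · rw [abs_mul]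
    exact mul_le_mul (hx l) (norm_le_pi_norm y l) (abs_nonneg _) ((abs_nonneg _).trans (hx l))
  · simp; ring

lemma abs_alpha_le (η : Idx n → ℝ) (i : Fin n) : |alpha η i| ≤ ‖η‖ := norm_le_pi_norm η _

lemma abs_beta_le (η : Idx n → ℝ) (j : Fin n) : |beta η j| ≤ ‖η‖ := by
  unfold beta; split_ifs
  · exact norm_le_pi_norm η _
  · simp

lemma abs_sum_u_mul_le {c : ℝ} {g : Fin n → Fin n → ℝ}
    (hg : ∀ i j, i ≠ j → |g i j| ≤ c) (i : Fin n) :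
    |∑ j, u Z η₀ γ₀ i j * g i j| ≤ c * uRow Z η₀ γ₀ i ∧
    |∑ j, u Z η₀ γ₀ j i * g j i| ≤ c * uCol Z η₀ γ₀ i := by
  have key : ∀ i j, |u Z η₀ γ₀ i j * g i j| ≤ c * u Z η₀ γ₀ i j := fun i j => by
    rw [abs_mul, abs_of_nonneg (u_nonneg i j), mul_comm]
    rcases eq_or_ne i j with rfl | hij
    · simp [u_self]
    · exact mul_le_mul_of_nonneg_right (hg i j hij) (u_nonneg i j)
  rw [uRow, uCol, Finset.mul_sum, Finset.mul_sum]
  exact ⟨(Finset.abs_sum_le_sum_abs _ _).trans (Finset.sum_le_sum fun j _ => key i j),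
    (Finset.abs_sum_le_sum_abs _ _).trans (Finset.sum_le_sum fun j _ => key j i)⟩

namespace Regular

variable {B M κ : ℝ}

lemma B_pos (h : Regular Z η₀ γ₀ B M κ) : 0 < B := by linarith [h.B_ge]

lemma n_pos (h : Regular Z η₀ γ₀ B M κ) : (0 : ℝ) < n := by
  have := h.four_le
  exact_mod_cast (by omega : 0 < n)

lemma abs_Z_u_le (h : Regular Z η₀ γ₀ B M κ) (i j : Fin n) (l : Fin p) :
    |u Z η₀ γ₀ i j * Z i j l| ≤ u Z η₀ γ₀ i j * M := by
  rw [abs_mul, abs_of_nonneg (u_nonneg i j)]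
  rcases eq_or_ne i j with rfl | hij
  · simp [u_self]
  · exact mul_le_mul_of_nonneg_left (h.Z_le i j hij l) (u_nonneg i j)

lemma abs_lin_le (h : Regular Z η₀ γ₀ B M κ) (θ : Param n p) {i j : Fin n} (hij : i ≠ j) :
    |lin Z θ i j| ≤ (2 + p * M) * ‖θ‖ := by
  have h1 := abs_alpha_le θ.1 i
  have h2 := abs_beta_le θ.1 j
  have h3 := abs_dotProduct_le (y := θ.2) (h.Z_le i j hij)
  have h4 := norm_fst_le θ
  have h5 := norm_snd_le θ
  have hM : 0 ≤ p * M := by have := h.M_ge; positivity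
  have h6 := mul_le_mul_of_nonneg_left h5 hM
  rw [lin_apply, linPred]
  refine (abs_add_three _ _ _).trans ?_
  linarith

/-- The bound for the node parameter alone. -/
lemma norm_eta_le (h : Regular Z η₀ γ₀ B M κ) {η : Idx n → ℝ} {w : Fin n → Fin n → ℝ} {δ : ℝ}
    (hη : V Z η₀ γ₀ *ᵥ η = (linT Z w).1)
    (hrow : ∀ i, |∑ j, w i j| ≤ δ * uRow Z η₀ γ₀ i)
    (hcol : ∀ j, |∑ i, w i j| ≤ δ * uCol Z η₀ γ₀ j) : ‖η‖ ≤ 5 / 2 * B * δ := by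
  have hB := h.B_pos
  have hn := h.four_le
  rw [← info_fst_of_eta, info_apply] at hη
  have hlin : ∀ i j, lin Z ((η, 0) : Param n p) i j = alpha η i + beta η j := fun i j => by
    simp [lin_apply, linPred]
  simp only [hlin] at hη
  have hr : ∀ i, _ = _ := fun i => congrFun hη (Sum.inl i)
  -- The oscillation argument needs all n column equations, although only n - 1 of them are
  -- coordinates of the system.
  have hc := col_sum_eq_of_linT_fst_eq hη
  have key := two_way_bound (w := u Z η₀ γ₀) (x := alpha η) (y := beta η) (δ := δ) (m := 1 / B)
    (j₀ := ⟨n - 1, by omega⟩) hn (by positivity) u_nonneg u_le h.u_ge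
    (fun i => by
      have := hr i
      rw [linT_inl, linT_inl] at this
      rw [this]; exact hrow i)
    (fun j => by rw [hc j]; exact hcol j) (beta_last η rfl)
  have he : 5 / 2 * δ / (1 / B) = 5 / 2 * B * δ := by field_simp
  rw [he] at key
  have h0 : 0 ≤ 5 / 2 * B * δ := (abs_nonneg _).trans (key.1 ⟨0, by omega⟩)
  refine (pi_norm_le_iff_of_nonneg h0).2 fun x => ?_
  rcases x with i | j
  · exact key.1 i
  · rw [← beta_incl η j]; exact key.2 _

/-- The bound with δ = 0 says that the kernel is trivial. -/
lemma isUnit_V (h : Regular Z η₀ γ₀ B M κ) : IsUnit (V Z η₀ γ₀) := by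
  rw [← Matrix.mulVec_injective_iff_isUnit]
  refine (injective_iff_map_eq_zero (Matrix.mulVecLin (V Z η₀ γ₀))).2 fun η hη => ?_
  have := h.norm_eta_le (η := η) (w := 0) (δ := 0)
    (by rw [map_zero]; exact hη) (by simp) (by simp)
  simpa using this

lemma V_mulVec_inv (h : Regular Z η₀ γ₀ B M κ) (f : Idx n → ℝ) :
    V Z η₀ γ₀ *ᵥ ((V Z η₀ γ₀)⁻¹ *ᵥ f) = f := by
  rw [Matrix.mulVec_mulVec,
    Matrix.mul_nonsing_inv _ ((Matrix.isUnit_iff_isUnit_det _).1 h.isUnit_V), Matrix.one_mulVec]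

lemma V_inv_mulVec (h : Regular Z η₀ γ₀ B M κ) (f : Idx n → ℝ) :
    (V Z η₀ γ₀)⁻¹ *ᵥ (V Z η₀ γ₀ *ᵥ f) = f := by
  rw [Matrix.mulVec_mulVec,
    Matrix.nonsing_inv_mul _ ((Matrix.isUnit_iff_isUnit_det _).1 h.isUnit_V), Matrix.one_mulVec]

/-- The regression of the covariates on the node parameters. -/
lemma norm_V_inv_mulVec_gamma_le (h : Regular Z η₀ γ₀ B M κ) (γ : Fin p → ℝ) :
    ‖(V Z η₀ γ₀)⁻¹ *ᵥ (Vηγ Z η₀ γ₀ *ᵥ γ)‖ ≤ 5 / 2 * B * (p * M * ‖γ‖) := by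
  refine h.norm_eta_le (w := fun i j => u Z η₀ γ₀ i j * lin Z ((0, γ) : Param n p) i j) ?_ ?_ ?_
  · rw [h.V_mulVec_inv, ← info_fst_of_gamma, info_apply]
  all_goals
    have hg : ∀ i j, i ≠ j → |lin Z ((0, γ) : Param n p) i j| ≤ p * M * ‖γ‖ := fun i j hij => by
      simp only [lin_apply, linPred, alpha, beta, Pi.zero_apply, dite_eq_ite, ite_self, zero_add]
      exact abs_dotProduct_le (h.Z_le i j hij)
  · exact fun i => (abs_sum_u_mul_le hg i).1
  · exact fun i => (abs_sum_u_mul_le hg i).2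

lemma norm_Vηγ_transpose_mulVec_le (h : Regular Z η₀ γ₀ B M κ) (η : Idx n → ℝ) :
    ‖(Vηγ Z η₀ γ₀)ᵀ *ᵥ η‖ ≤ 1 / 2 * M * ‖η‖ * (n : ℝ) ^ 2 := by
  have hM := h.M_ge
  refine (pi_norm_le_iff_of_nonneg (by positivity)).2 fun l => ?_
  rw [← info_snd_of_eta, info_apply, linT_snd]
  refine sum_sum_le_sq fun i j => ?_
  have h1 : |lin Z ((η, 0) : Param n p) i j| ≤ 2 * ‖η‖ := by
    simp only [lin_apply, linPred, dotProduct_zero, add_zero]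
    refine (abs_add_le _ _).trans ?_
    linarith [abs_alpha_le η i, abs_beta_le η j]
  rw [mul_right_comm, abs_mul]
  have h2 := h.abs_Z_u_le i j l
  have h3 : u Z η₀ γ₀ i j * M ≤ 1 / 4 * M := by gcongr; exact u_le i j
  calc _ ≤ (1 / 4 * M) * (2 * ‖η‖) := mul_le_mul (h2.trans h3) h1 (abs_nonneg _) (by positivity)
    _ = _ := by ring

lemma norm_Vγγ_mulVec_le (h : Regular Z η₀ γ₀ B M κ) (γ : Fin p → ℝ) :
    ‖Vγγ Z η₀ γ₀ *ᵥ γ‖ ≤ 1 / 4 * M * (p * M * ‖γ‖) * (n : ℝ) ^ 2 := by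
  have hM := h.M_ge
  refine (pi_norm_le_iff_of_nonneg (by positivity)).2 fun l => ?_
  rw [← info_snd_of_gamma, info_apply, linT_snd]
  refine sum_sum_le_sq fun i j => ?_
  rcases eq_or_ne i j with rfl | hij
  · simp only [u_self, zero_mul, abs_zero]; positivity
  have h1 : |lin Z ((0, γ) : Param n p) i j| ≤ p * M * ‖γ‖ := by
    simp only [lin_apply, linPred, alpha, beta, Pi.zero_apply, dite_eq_ite, ite_self, zero_add]
    exact abs_dotProduct_le (h.Z_le i j hij)
  rw [mul_right_comm, abs_mul]
  have h2 := h.abs_Z_u_le i j l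
  have h3 : u Z η₀ γ₀ i j * M ≤ 1 / 4 * M := by gcongr; exact u_le i j
  exact mul_le_mul (h2.trans h3) h1 (abs_nonneg _) (by positivity)

lemma H_inv_mulVec (h : Regular Z η₀ γ₀ B M κ) (γ : Fin p → ℝ) :
    (H Z η₀ γ₀)⁻¹ *ᵥ (H Z η₀ γ₀ *ᵥ γ) = γ := by
  rw [Matrix.mulVec_mulVec, Matrix.nonsing_inv_mul _
    ((Matrix.isUnit_iff_isUnit_det _).1 h.H_posDef.isUnit), Matrix.one_mulVec]

lemma H_mulVec (γ : Fin p → ℝ) : H Z η₀ γ₀ *ᵥ γ =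
    Vγγ Z η₀ γ₀ *ᵥ γ - (Vηγ Z η₀ γ₀)ᵀ *ᵥ ((V Z η₀ γ₀)⁻¹ *ᵥ (Vηγ Z η₀ γ₀ *ᵥ γ)) := by
  rw [H, Matrix.sub_mulVec, Matrix.mulVec_mulVec, Matrix.mulVec_mulVec, Matrix.mul_assoc]

/-- The norm of `γ` is controlled by `H γ`. -/
lemma norm_gamma_le (h : Regular Z η₀ γ₀ B M κ) {γ : Fin p → ℝ} {c : ℝ}
    (hγ : ‖H Z η₀ γ₀ *ᵥ γ‖ ≤ c * (n : ℝ) ^ 2) : ‖γ‖ ≤ κ * c := by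
  have hn := h.n_pos
  have h1 := abs_mulVec_le_infNorm (H Z η₀ γ₀)⁻¹ (H Z η₀ γ₀ *ᵥ γ)
  rw [h.H_inv_mulVec] at h1
  -- Nonnegativity of the norm is tested on the vector of ones, which is nonzero because p ≥ 1.
  have h0 : 0 ≤ κ / (n : ℝ) ^ 2 := by
    refine le_trans ?_ h.H_inv_le
    by_contra! hneg
    have := abs_mulVec_le_infNorm (H Z η₀ γ₀)⁻¹ (fun _ => 1)
    have hp : 0 < ‖(fun _ : Fin p => (1 : ℝ))‖ := by
      refine norm_pos_iff.2 fun h' => ?_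
      have := congrFun h' ⟨0, h.p_pos⟩
      simp at this
    nlinarith [norm_nonneg ((H Z η₀ γ₀)⁻¹ *ᵥ (fun _ => 1))]
  calc ‖γ‖ ≤ _ := h1
    _ ≤ κ / (n : ℝ) ^ 2 * (c * (n : ℝ) ^ 2) := mul_le_mul h.H_inv_le hγ (norm_nonneg _) h0
    _ = κ * c := by field_simp

/-- The bound on the inverse profile information cannot be too small. -/
lemma one_le_kappa_mul (h : Regular Z η₀ γ₀ B M κ) : 1 ≤ κ * (2 * p * M ^ 2 * B) := by
  have hM := h.M_ge
  have hB := h.B_ge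
  have hn := h.n_pos
  -- A unit test vector: ‖He‖ is at most (1/4 + 5B/4)pM²n², hence at most 2pM²Bn². The resulting
  -- lower bound on κ later inserts κ into error terms that lack it.
  let e : Fin p → ℝ := fun _ => 1
  have he : ‖e‖ = 1 := by
    have : Nonempty (Fin p) := ⟨⟨0, h.p_pos⟩⟩
    rw [pi_norm_const]; simp
  rw [← he]
  refine h.norm_gamma_le ?_
  rw [H_mulVec]
  refine (norm_sub_le _ _).trans ?_
  have h1 := h.norm_Vγγ_mulVec_le e
  have h2 := (h.norm_Vηγ_transpose_mulVec_le _).trans (mul_le_mul_of_nonneg_right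
    (mul_le_mul_of_nonneg_left (h.norm_V_inv_mulVec_gamma_le e) (by positivity : 0 ≤ 1 / 2 * M))
    (by positivity : (0 : ℝ) ≤ (n : ℝ) ^ 2))
  refine (add_le_add h1 h2).trans ?_
  rw [he, ← add_mul]
  refine mul_le_mul_of_nonneg_right ?_ (by positivity)
  have : 0 ≤ p * M ^ 2 := by positivity
  nlinarith

lemma kappa_pos (h : Regular Z η₀ γ₀ B M κ) : 0 < κ := by
  have h1 := h.one_le_kappa_mul
  have hM := h.M_ge
  have hB := h.B_ge
  have : 0 ≤ 2 * p * M ^ 2 * B := by positivity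
  by_contra! hneg
  nlinarith

/-- The sup-norm bound for the solution of the linearized likelihood equations. -/
lemma norm_le_of_info_eq (h : Regular Z η₀ γ₀ B M κ) {θ : Param n p} {w : Fin n → Fin n → ℝ} {δ : ℝ}
    (hθ : info Z η₀ γ₀ θ = linT Z w)
    (hrow : ∀ i, |∑ j, w i j| ≤ δ * uRow Z η₀ γ₀ i)
    (hcol : ∀ j, |∑ i, w i j| ≤ δ * uCol Z η₀ γ₀ j)
    (hcov : ∀ l, |∑ i, ∑ j, w i j * Z i j l| ≤ M * δ * (n : ℝ) ^ 2) :
    ‖θ‖ ≤ 10 * p * M ^ 2 * κ * B ^ 2 * δ := by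
  have hM := h.M_ge
  have hB := h.B_ge
  have hn := h.n_pos
  have hκ := h.kappa_pos
  have hp : (1 : ℝ) ≤ p := by exact_mod_cast h.p_pos
  obtain ⟨η, γ⟩ := θ
  -- Block elimination: x is the node parameter that would result from γ = 0. The true η is x minus
  -- the regression on γ, and γ solves the Schur complement equation.
  set x := (V Z η₀ γ₀)⁻¹ *ᵥ (linT Z w).1 with hx
  have hxn : ‖x‖ ≤ 5 / 2 * B * δ := h.norm_eta_le (h.V_mulVec_inv _) hrow hcol
  have hδ : 0 ≤ δ := by
    have : 0 ≤ 5 / 2 * B * δ := (norm_nonneg x).trans hxn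
    by_contra! hneg
    nlinarith
  rw [info_eq, Prod.ext_iff] at hθ
  obtain ⟨h1, h2⟩ := hθ
  dsimp only at h1 h2
  have hηx : η = x - (V Z η₀ γ₀)⁻¹ *ᵥ (Vηγ Z η₀ γ₀ *ᵥ γ) := by
    rw [hx, ← h1, Matrix.mulVec_add, h.V_inv_mulVec, add_sub_cancel_right]
  have hHγ : H Z η₀ γ₀ *ᵥ γ = (linT Z w).2 - (Vηγ Z η₀ γ₀)ᵀ *ᵥ x := by
    rw [H_mulVec, ← h2, hηx, Matrix.mulVec_sub]
    abel
  have hq : ‖(linT Z w).2‖ ≤ M * δ * (n : ℝ) ^ 2 :=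
    (pi_norm_le_iff_of_nonneg (by positivity)).2 hcov
  have hγ : ‖γ‖ ≤ κ * (2 * M * B * δ) := by
    refine h.norm_gamma_le ?_
    rw [hHγ]
    refine (norm_sub_le _ _).trans ?_
    have e1 := (h.norm_Vηγ_transpose_mulVec_le x).trans (mul_le_mul_of_nonneg_right
      (mul_le_mul_of_nonneg_left hxn (by positivity : 0 ≤ 1 / 2 * M))
      (by positivity : (0 : ℝ) ≤ (n : ℝ) ^ 2))
    refine (add_le_add hq e1).trans ?_
    rw [← add_mul]
    refine mul_le_mul_of_nonneg_right ?_ (by positivity)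
    have : 0 ≤ M * δ := by positivity
    nlinarith
  have hη : ‖η‖ ≤ 10 * p * M ^ 2 * κ * B ^ 2 * δ := by
    rw [hηx]
    refine (norm_sub_le _ _).trans ?_
    have e1 := h.norm_V_inv_mulVec_gamma_le γ
    have e2 : 5 / 2 * B * (p * M * ‖γ‖) ≤ 5 / 2 * B * (p * M * (κ * (2 * M * B * δ))) := by
      gcongr
    -- The term without κ is enlarged to the shape of the other one; each then contributes 5pM²κB²δ,
    -- whence the constant 10.
    have e3 : 5 / 2 * B * δ ≤ 5 / 2 * B * δ * (κ * (2 * p * M ^ 2 * B)) :=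
      le_mul_of_one_le_right (by positivity) h.one_le_kappa_mul
    calc _ ≤ 5 / 2 * B * δ * (κ * (2 * p * M ^ 2 * B))
          + 5 / 2 * B * (p * M * (κ * (2 * M * B * δ))) :=
          add_le_add (hxn.trans e3) (e1.trans e2)
      _ = _ := by ring
  refine max_le hη (hγ.trans ?_)
  have : κ * (2 * M * B * δ) * 1 ≤ κ * (2 * M * B * δ) * (5 * p * M * B) :=
    mul_le_mul_of_nonneg_left (by
      nlinarith [mul_pos (by linarith : 0 < M) (by linarith : 0 < B),
        mul_le_mul hp hM zero_le_one (by linarith)]) (by positivity)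
  calc _ = κ * (2 * M * B * δ) * 1 := by ring
    _ ≤ _ := this
    _ = _ := by ring

lemma info_injective (h : Regular Z η₀ γ₀ B M κ) : Function.Injective (info Z η₀ γ₀) := by
  refine (injective_iff_map_eq_zero _).2 fun θ hθ => ?_
  have := h.norm_le_of_info_eq (θ := θ) (w := 0) (δ := 0) (by rw [hθ, map_zero]) (by simp)
    (by simp) (by simp)
  simpa using this

end Regular

end

noncomputable section

variable {n p : ℕ} {Z : Fin n → Fin n → Fin p → ℝ} {η₀ : Idx n → ℝ} {γ₀ : Fin p → ℝ}

/-! ### The likelihood equations -/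

/-- The residuals `a_{ij} - μ(π_{ij})`, with zero diagonal. -/
def resid (Z : Fin n → Fin n → Fin p → ℝ) (a : Adj n) (η : Idx n → ℝ) (γ : Fin p → ℝ)
    (i j : Fin n) : ℝ :=
  if i = j then 0 else (if a i j = true then 1 else 0) - mu (linPred Z η γ i j)

lemma logLik_eq (a : Adj n) (η : Idx n → ℝ) (γ : Fin p → ℝ) :
    logLik Z a η γ = ∑ i, ∑ j, if i = j then 0 else
      ((if a i j = true then linPred Z η γ i j else 0)
        - Real.log (1 + Real.exp (linPred Z η γ i j))) := by
  unfold logLik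
  refine Finset.sum_congr rfl fun i _ => ?_
  rw [← Finset.sum_erase Finset.univ (a := i) (by simp)]
  refine Finset.sum_congr rfl fun j hj => ?_
  rw [if_neg (Finset.ne_of_mem_erase hj).symm]

/-- The gradient inequality for the concave log-likelihood, entry by entry. -/
lemma logLik_entry_le (a : Adj n) (η η' : Idx n → ℝ) (γ γ' : Fin p → ℝ) (i j : Fin n) :
    (if i = j then 0 else ((if a i j = true then linPred Z η' γ' i j else 0)
        - Real.log (1 + Real.exp (linPred Z η' γ' i j))))
      ≤ (if i = j then 0 else ((if a i j = true then linPred Z η γ i j else 0)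
        - Real.log (1 + Real.exp (linPred Z η γ i j))))
        + resid Z a η γ i j * lin Z ((η', γ') - (η, γ)) i j := by
  unfold resid
  split_ifs with h1 h2
  · simp
  all_goals
    have := log_one_add_exp_tangent_le (linPred Z η γ i j) (linPred Z η' γ' i j)
    rw [map_sub, Pi.sub_apply, Pi.sub_apply, lin_apply, lin_apply]
    dsimp only
    nlinarith

/-- Concavity makes critical points global maximizers: the linear terms of the gradient inequality
add up to the pairing of the score with the displacement, which vanishes. -/
lemma logLik_le (a : Adj n) {η : Idx n → ℝ} {γ : Fin p → ℝ}
    (h : linT Z (resid Z a η γ) = 0) : IsMLE Z a η γ := by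
  intro η' γ'
  rw [logLik_eq, logLik_eq]
  have h0 := sum_mul_lin Z (resid Z a η γ) ((η', γ') - (η, γ))
  rw [h] at h0
  simp only [Prod.fst_zero, Prod.snd_zero, zero_dotProduct, add_zero] at h0
  refine (Finset.sum_le_sum fun i _ => Finset.sum_le_sum fun j _ =>
    logLik_entry_le a η η' γ γ' i j).trans (le_of_eq ?_)
  simp only [Finset.sum_add_distrib, h0, add_zero]

/-- A solution of the likelihood equations and a maximizer have the same linear predictor. -/
lemma lin_sub_eq_zero_of_isMLE (a : Adj n) {η η' : Idx n → ℝ} {γ γ' : Fin p → ℝ}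
    (h : linT Z (resid Z a η γ) = 0) (h' : IsMLE Z a η' γ') {i j : Fin n} (hij : i ≠ j) :
    lin Z ((η', γ') - (η, γ)) i j = 0 := by
  by_contra hne
  have h0 := sum_mul_lin Z (resid Z a η γ) ((η', γ') - (η, γ))
  rw [h] at h0
  simp only [Prod.fst_zero, Prod.snd_zero, zero_dotProduct, add_zero] at h0
  refine absurd (h' η γ) (not_le.2 ?_)
  rw [logLik_eq, logLik_eq]
  -- The single pair with differing predictors makes the gradient inequality strict, contradicting
  -- maximality at (η', γ').
  have key : ∑ i, ∑ j, (if i = j then 0 else ((if a i j = true then linPred Z η' γ' i j else 0)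
        - Real.log (1 + Real.exp (linPred Z η' γ' i j))))
      < ∑ i, ∑ j, ((if i = j then 0 else ((if a i j = true then linPred Z η γ i j else 0)
        - Real.log (1 + Real.exp (linPred Z η γ i j))))
        + resid Z a η γ i j * lin Z ((η', γ') - (η, γ)) i j) := by
    refine Finset.sum_lt_sum (fun i _ => Finset.sum_le_sum fun j _ =>
      logLik_entry_le a η η' γ γ' i j) ⟨i, Finset.mem_univ _, ?_⟩
    refine Finset.sum_lt_sum (fun j _ => logLik_entry_le a η η' γ γ' i j)
      ⟨j, Finset.mem_univ _, ?_⟩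
    rw [map_sub, Pi.sub_apply, Pi.sub_apply, lin_apply, lin_apply, sub_eq_zero] at hne
    have := log_one_add_exp_tangent_lt hne
    dsimp only at this
    unfold resid
    rw [map_sub, Pi.sub_apply, Pi.sub_apply, lin_apply, lin_apply]
    dsimp only
    rw [if_neg hij, if_neg hij, if_neg hij]
    split_ifs <;> nlinarith
  simpa only [Finset.sum_add_distrib, h0, add_zero] using key

/-- Equal predictors off the diagonal put the difference in the kernel of `info`, as u vanishes on
the diagonal. Thus whatever maximizer the estimator selects, its node part is that of the
constructed solution. -/
lemma Regular.eq_of_isMLE {B M κ : ℝ} (hreg : Regular Z η₀ γ₀ B M κ) (a : Adj n)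
    {η η' : Idx n → ℝ} {γ γ' : Fin p → ℝ}
    (h : linT Z (resid Z a η γ) = 0) (h' : IsMLE Z a η' γ') : η' = η := by
  have h0 : info Z η₀ γ₀ ((η', γ') - (η, γ)) = 0 := by
    rw [info_apply, ← map_zero (linT Z)]
    congr 1
    ext i j
    rcases eq_or_ne i j with rfl | hij
    · simp [u_self]
    · rw [lin_sub_eq_zero_of_isMLE a h h' hij]; simp
  have := hreg.info_injective (h0.trans (map_zero _).symm)
  exact (Prod.ext_iff.1 (sub_eq_zero.1 this)).1

/-! ### Expansion of the maximum likelihood estimate -/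

/-- The remainder of the linearization of the means at `(η₀, γ₀)`. -/
def remainder (Z : Fin n → Fin n → Fin p → ℝ) (η₀ : Idx n → ℝ) (γ₀ : Fin p → ℝ) (θ : Param n p)
    (i j : Fin n) : ℝ :=
  if i = j then 0 else mu (linPred Z η₀ γ₀ i j + lin Z θ i j) - mu (linPred Z η₀ γ₀ i j)
    - muDeriv (linPred Z η₀ γ₀ i j) * lin Z θ i j

/-- This exact splitting turns the likelihood equations into a fixed-point equation. -/
lemma resid_add (a : Adj n) (θ : Param n p) (i j : Fin n) :
    resid Z a (η₀ + θ.1) (γ₀ + θ.2) i j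
      = resid Z a η₀ γ₀ i j - remainder Z η₀ γ₀ θ i j - u Z η₀ γ₀ i j * lin Z θ i j := by
  have : linPred Z (η₀ + θ.1) (γ₀ + θ.2) i j = linPred Z η₀ γ₀ i j + lin Z θ i j := by
    change lin Z ((η₀, γ₀) + θ) i j = lin Z (η₀, γ₀) i j + lin Z θ i j
    rw [map_add]; rfl
  unfold resid remainder u
  rw [this]
  split_ifs <;> ring

namespace Regular

variable {B M κ : ℝ}

/-- One factor 2 + pM converts the radius of the ball into a range of predictors, the other converts
the distance of the parameters. The factor u_ij makes the bound fit `norm_le_of_entries`. -/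
lemma abs_remainder_sub_le (h : Regular Z η₀ γ₀ B M κ) {r : ℝ} (hr : (2 + p * M) * r ≤ 1)
    {θ θ' : Param n p} (hθ : ‖θ‖ ≤ r) (hθ' : ‖θ'‖ ≤ r) (i j : Fin n) :
    |remainder Z η₀ γ₀ θ i j - remainder Z η₀ γ₀ θ' i j|
      ≤ u Z η₀ γ₀ i j * (2 * (2 + p * M) ^ 2 * r * ‖θ - θ'‖) := by
  have hM := h.M_ge
  have hA : 0 ≤ 2 + p * M := by positivity
  unfold remainder u
  split_ifs with hij
  · simp
  · set π := linPred Z η₀ γ₀ i j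
    have h1 := (h.abs_lin_le θ hij).trans (mul_le_mul_of_nonneg_left hθ hA)
    have h2 := (h.abs_lin_le θ' hij).trans (mul_le_mul_of_nonneg_left hθ' hA)
    have h3 := h.abs_lin_le (θ - θ') hij
    rw [map_sub, Pi.sub_apply, Pi.sub_apply] at h3
    have h4 := abs_mu_sub_mu_sub_le (x₀ := π) (x := π + lin Z θ i j) (y := π + lin Z θ' i j)
      (ρ := (2 + p * M) * r) (by simpa using h1) (by simpa using h2) hr
    rw [add_sub_add_left_eq_sub] at h4
    have hr0 : 0 ≤ r := (norm_nonneg θ).trans hθ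
    calc _ = |mu (π + lin Z θ i j) - mu (π + lin Z θ' i j)
          - muDeriv π * (lin Z θ i j - lin Z θ' i j)| := by congr 1; ring
      _ ≤ _ := h4
      _ ≤ 2 * ((2 + p * M) * r) * muDeriv π * ((2 + p * M) * ‖θ - θ'‖) :=
        mul_le_mul_of_nonneg_left h3 (by have := muDeriv_pos π; positivity)
      _ = _ := by ring

/-- The bound for the solution of the linearized equations whose right-hand side is entrywise
small relative to the variances. -/
lemma norm_le_of_entries (h : Regular Z η₀ γ₀ B M κ) {θ : Param n p} {w : Fin n → Fin n → ℝ}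
    {δ : ℝ} (hδ : 0 ≤ δ) (hθ : info Z η₀ γ₀ θ = linT Z w)
    (hw : ∀ i j, |w i j| ≤ u Z η₀ γ₀ i j * δ) :
    ‖θ‖ ≤ 10 * p * M ^ 2 * κ * B ^ 2 * δ := by
  have hM := h.M_ge
  refine h.norm_le_of_info_eq hθ (fun i => ?_) (fun j => ?_) (fun l => ?_)
  · rw [uRow, mul_comm, Finset.sum_mul]
    exact (Finset.abs_sum_le_sum_abs _ _).trans (Finset.sum_le_sum fun j _ => hw i j)
  · rw [uCol, mul_comm, Finset.sum_mul]
    exact (Finset.abs_sum_le_sum_abs _ _).trans (Finset.sum_le_sum fun i _ => hw i j)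
  · refine sum_sum_le_sq fun i j => ?_
    rw [abs_mul]
    rcases eq_or_ne i j with rfl | hij
    · have := hw i i
      rw [u_self, zero_mul] at this
      rw [le_antisymm this (abs_nonneg _), zero_mul]
      positivity
    · have h1 : |w i j| ≤ 1 * δ :=
        (hw i j).trans (mul_le_mul_of_nonneg_right ((u_le i j).trans (by norm_num)) hδ)
      calc _ ≤ (1 * δ) * M := mul_le_mul h1 (h.Z_le i j hij l) (abs_nonneg _) (by linarith)
        _ = _ := by ring

/-- Existence of a solution of the likelihood equations near the solution of the linearized
equations, by the contraction principle. -/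
lemma exists_solution (h : Regular Z η₀ γ₀ B M κ) (a : Adj n) {θ₁ : Param n p} {r Λ : ℝ}
    (hΛ : Λ = 10 * p * M ^ 2 * κ * B ^ 2)
    (hθ₁ : info Z η₀ γ₀ θ₁ = linT Z (resid Z a η₀ γ₀)) (hr₁ : ‖θ₁‖ ≤ r / 2)
    (hr : (2 + p * M) * r ≤ 1) (hrΛ : Λ * (2 * (2 + p * M) ^ 2 * r) ≤ 1 / 2) :
    ∃ θ : Param n p, linT Z (resid Z a (η₀ + θ.1) (γ₀ + θ.2)) = 0 ∧
      ‖θ - θ₁‖ ≤ Λ * (2 * (2 + p * M) ^ 2 * r) * r := by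
  have hM := h.M_ge
  have hr0 : 0 ≤ r := by linarith [norm_nonneg θ₁]
  let e := LinearEquiv.ofInjectiveEndo (info Z η₀ γ₀) h.info_injective
  have he : ∀ x, info Z η₀ γ₀ (e.symm x) = x := fun x => e.apply_symm_apply x
  -- By `resid_add`, fixed points of Φ are solutions of the likelihood equations.
  let Φ : Param n p → Param n p := fun θ => θ₁ - e.symm (linT Z (remainder Z η₀ γ₀ θ))
  have hLip : ∀ θ θ' : Param n p, ‖θ‖ ≤ r → ‖θ'‖ ≤ r →
      ‖Φ θ - Φ θ'‖ ≤ Λ * (2 * (2 + p * M) ^ 2 * r) * ‖θ - θ'‖ := fun θ θ' hθ hθ' => by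
    have h1 : Φ θ - Φ θ' = e.symm (linT Z (remainder Z η₀ γ₀ θ' - remainder Z η₀ γ₀ θ)) := by
      simp only [Φ, map_sub]; abel
    rw [h1, hΛ, mul_assoc (10 * p * M ^ 2 * κ * B ^ 2)]
    refine h.norm_le_of_entries (by positivity) (he _) fun i j => ?_
    rw [Pi.sub_apply, Pi.sub_apply, abs_sub_comm]
    exact h.abs_remainder_sub_le hr hθ hθ' i j
  have hΦ0 : Φ 0 = θ₁ := by
    have : remainder Z η₀ γ₀ 0 = 0 := by
      ext i j; simp [remainder]
    simp [Φ, this]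
  have hhalf : ∀ θ θ' : Param n p, ‖θ‖ ≤ r → ‖θ'‖ ≤ r → ‖Φ θ - Φ θ'‖ ≤ 1 / 2 * ‖θ - θ'‖ :=
    fun θ θ' hθ hθ' => (hLip θ θ' hθ hθ').trans (mul_le_mul_of_nonneg_right hrΛ (norm_nonneg _))
  have hz : ‖(0 : Param n p)‖ ≤ r := by simpa using hr0
  have hmaps : Set.MapsTo Φ (Metric.closedBall 0 r) (Metric.closedBall 0 r) := fun θ hθ => by
    rw [mem_closedBall_zero_iff] at hθ ⊢
    have h1 := hhalf θ 0 hθ hz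
    rw [hΦ0, sub_zero] at h1
    calc ‖Φ θ‖ ≤ ‖Φ θ - θ₁‖ + ‖θ₁‖ := by simpa using norm_add_le (Φ θ - θ₁) θ₁
      _ ≤ _ := by linarith
  have hcontr : ContractingWith (1 / 2) (hmaps.restrict Φ _ _) := by
    refine ⟨by rw [← NNReal.coe_lt_coe]; norm_num, LipschitzWith.of_dist_le_mul fun x y => ?_⟩
    have h1 := hhalf x y (mem_closedBall_zero_iff.1 x.2) (mem_closedBall_zero_iff.1 y.2)
    rw [Subtype.dist_eq, Subtype.dist_eq, dist_eq_norm, dist_eq_norm]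
    simpa using h1
  obtain ⟨θ, hθs, hfix, -, -⟩ := hcontr.exists_fixedPoint' (x := 0)
    Metric.isClosed_closedBall.isComplete hmaps (by simpa using hr0) (edist_ne_top _ _)
  rw [mem_closedBall_zero_iff] at hθs
  have hfix' : Φ θ = θ := hfix
  refine ⟨θ, ?_, ?_⟩
  · have h1 : resid Z a (η₀ + θ.1) (γ₀ + θ.2) = resid Z a η₀ γ₀ - remainder Z η₀ γ₀ θ
        - fun i j => u Z η₀ γ₀ i j * lin Z θ i j := by
      ext i j; exact resid_add a θ i j
    have h2 : info Z η₀ γ₀ θ = linT Z (resid Z a η₀ γ₀) - linT Z (remainder Z η₀ γ₀ θ) := by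
      conv_lhs => rw [← hfix']
      simp only [Φ, map_sub, hθ₁, he]
    rw [h1, map_sub, map_sub, ← info_apply, h2, sub_self]
  -- Since Φ 0 = θ₁, the Lipschitz bound compares θ with θ₁. The constant proportional to r is used
  -- instead of 1/2, so that the error is quadratic in r.
  · have h1 := hLip θ 0 hθs hz
    rw [hΦ0, hfix', sub_zero] at h1
    have h2 : 0 ≤ Λ * (2 * (2 + p * M) ^ 2 * r) := by
      have := h.kappa_pos
      rw [hΛ]; positivity
    exact h1.trans (mul_le_mul_of_nonneg_left hθs h2)

lemma uRow_ge (h : Regular Z η₀ γ₀ B M κ) (i : Fin n) : n / (2 * B) ≤ uRow Z η₀ γ₀ i := by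
  have hB := h.B_pos
  have hn : (4 : ℝ) ≤ n := by exact_mod_cast h.four_le
  have h1 : ∑ j ∈ Finset.univ.erase i, 1 / B ≤ uRow Z η₀ γ₀ i :=
    (Finset.sum_le_sum fun j hj => h.u_ge i j (Finset.ne_of_mem_erase hj).symm).trans
      (Finset.sum_le_univ_sum_of_nonneg fun j => u_nonneg i j)
  refine le_trans ?_ h1
  rw [Finset.sum_const, Finset.card_erase_of_mem (Finset.mem_univ _), Finset.card_univ,
    Fintype.card_fin, nsmul_eq_mul, Nat.cast_sub (by have := h.four_le; omega), ← div_div,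
    mul_one_div]
  gcongr
  push_cast
  linarith

lemma uCol_ge (h : Regular Z η₀ γ₀ B M κ) (j : Fin n) : n / (2 * B) ≤ uCol Z η₀ γ₀ j := by
  have hB := h.B_pos
  have hn : (4 : ℝ) ≤ n := by exact_mod_cast h.four_le
  have h1 : ∑ i ∈ Finset.univ.erase j, 1 / B ≤ uCol Z η₀ γ₀ j :=
    (Finset.sum_le_sum fun i hi => h.u_ge i j (Finset.ne_of_mem_erase hi)).trans
      (Finset.sum_le_univ_sum_of_nonneg fun i => u_nonneg i j)
  refine le_trans ?_ h1
  rw [Finset.sum_const, Finset.card_erase_of_mem (Finset.mem_univ _), Finset.card_univ,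
    Fintype.card_fin, nsmul_eq_mul, Nat.cast_sub (by have := h.four_le; omega), ← div_div,
    mul_one_div]
  gcongr
  push_cast
  linarith

lemma uRow_pos (h : Regular Z η₀ γ₀ B M κ) (i : Fin n) : 0 < uRow Z η₀ γ₀ i :=
  lt_of_lt_of_le (by have := h.B_pos; have := h.n_pos; positivity) (h.uRow_ge i)

lemma uCol_pos (h : Regular Z η₀ γ₀ B M κ) (j : Fin n) : 0 < uCol Z η₀ γ₀ j :=
  lt_of_lt_of_le (by have := h.B_pos; have := h.n_pos; positivity) (h.uCol_ge j)

/-- The stochastic expansion of the maximum likelihood estimate, on the event where the listed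
linear statistics of the residuals are small. -/
theorem mle_expansion (h : Regular Z η₀ γ₀ B M κ) (a : Adj n) {X : Fin n → Fin n → ℝ}
    (hX : X = resid Z a η₀ γ₀) {F G : Fin n → ℝ}
    (hF : ∀ i, F i = (∑ j, X i j) / uRow Z η₀ γ₀ i)
    (hG : ∀ j, G j = (∑ i, X i j) / uCol Z η₀ γ₀ j)
    {last : Fin n} (hlast : (last : ℕ) = n - 1) {τ δ r Λ : ℝ}
    (hΛ : Λ = 10 * p * M ^ 2 * κ * B ^ 2)
    (hFτ : ∀ i, |F i| ≤ τ) (hGτ : ∀ j, |G j| ≤ τ)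
    (hrow : ∀ i, |∑ j, u Z η₀ γ₀ i j * G j| ≤ δ * uRow Z η₀ γ₀ i)
    (hcol : ∀ j, |∑ i, u Z η₀ γ₀ i j * F i| ≤ δ * uCol Z η₀ γ₀ j)
    (hcov : ∀ l, |∑ i, ∑ j, (X i j - u Z η₀ γ₀ i j * (F i + G j)) * Z i j l|
      ≤ M * δ * (n : ℝ) ^ 2)
    (hrτ : 2 * τ + Λ * δ ≤ r / 2)
    (hr : (2 + p * M) * r ≤ 1) (hrΛ : Λ * (2 * (2 + p * M) ^ 2 * r) ≤ 1 / 2) :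
    (∃ η γ, IsMLE Z a η γ) ∧ ∀ η γ, IsMLE Z a η γ → ∀ i,
      |η (Sum.inl i) - η₀ (Sum.inl i) - (F i + G last)|
        ≤ Λ * δ + Λ * (2 * (2 + p * M) ^ 2 * r) * r := by
  let e := LinearEquiv.ofInjectiveEndo (info Z η₀ γ₀) h.info_injective
  set θ₁ := e.symm (linT Z X) with hθ₁
  have hJ : info Z η₀ γ₀ θ₁ = linT Z X := e.apply_symm_apply _
  -- The node part is S applied to the node score: the entries 1/u_{·n} of S combine all row sums
  -- and the first n - 1 column sums into the last column sum.
  let ξ : Param n p := (Sum.elim (fun i => F i + G last) (fun j => G (incl j) - G last), 0)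
  have hξlin : ∀ i j, lin Z ξ i j = F i + G j := fun i j => by
    have hb : beta ξ.1 j = G j - G last := by
      by_cases hj : (j : ℕ) < n - 1
      · unfold beta; rw [dif_pos hj]; rfl
      · have : j = last := Fin.ext (by have := j.2; omega)
        rw [this, beta_last _ hlast, sub_self]
    rw [lin_apply, linPred, hb, dotProduct_zero, add_zero]
    change F i + G last + _ = _
    ring
  have hξ : ‖ξ‖ ≤ 2 * τ := by
    have hτ : 0 ≤ τ := (abs_nonneg _).trans (hFτ last)
    refine max_le ((pi_norm_le_iff_of_nonneg (by linarith)).2 fun x => ?_)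
      (by change ‖(0 : Fin p → ℝ)‖ ≤ _; simpa using hτ)
    rcases x with i | j
    · exact (abs_add_le _ _).trans (by linarith [hFτ i, hGτ last])
    · exact (abs_sub _ _).trans (by linarith [hGτ (incl j), hGτ last])
  -- In the defect of ξ the row sum of X cancels against u_{i·}F_i, leaving a weighted sum of the
  -- G_j; columns behave likewise with the F_i.
  have hdiff : ‖θ₁ - ξ‖ ≤ Λ * δ := by
    rw [hΛ]
    refine h.norm_le_of_info_eq (w := fun i j => X i j - u Z η₀ γ₀ i j * (F i + G j)) ?_ ?_ ?_ hcov
    · rw [map_sub, hJ, info_apply, ← map_sub]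
      simp only [hξlin]
      rfl
    · intro i
      have e1 : ∑ j, (X i j - u Z η₀ γ₀ i j * (F i + G j)) = -∑ j, u Z η₀ γ₀ i j * G j := by
        simp only [mul_add, Finset.sum_sub_distrib, Finset.sum_add_distrib, ← Finset.sum_mul]
        have e2 : (∑ j, u Z η₀ γ₀ i j) * F i = ∑ j, X i j := by
          rw [hF]; exact mul_div_cancel₀ _ (h.uRow_pos i).ne'
        rw [e2]; ring
      rw [e1, abs_neg]; exact hrow i
    · intro j
      have e1 : ∑ i, (X i j - u Z η₀ γ₀ i j * (F i + G j)) = -∑ i, u Z η₀ γ₀ i j * F i := by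
        simp only [mul_add, Finset.sum_sub_distrib, Finset.sum_add_distrib, ← Finset.sum_mul]
        have e2 : (∑ i, u Z η₀ γ₀ i j) * G j = ∑ i, X i j := by
          rw [hG]; exact mul_div_cancel₀ _ (h.uCol_pos j).ne'
        rw [e2]; ring
      rw [e1, abs_neg]; exact hcol j
  have hθ₁n : ‖θ₁‖ ≤ r / 2 := by
    calc ‖θ₁‖ ≤ ‖θ₁ - ξ‖ + ‖ξ‖ := by simpa using norm_add_le (θ₁ - ξ) ξ
      _ ≤ _ := by linarith
  obtain ⟨θ, hθ, hθd⟩ := h.exists_solution a hΛ (by rw [hJ, hX]) hθ₁n hr hrΛ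
  refine ⟨⟨_, _, logLik_le a hθ⟩, fun η γ hη i => ?_⟩
  rw [h.eq_of_isMLE a hθ hη, Pi.add_apply, add_sub_cancel_left]
  have h1 : |(θ - ξ).1 (Sum.inl i)| ≤ ‖θ - ξ‖ := (norm_le_pi_norm (θ - ξ).1 _).trans (norm_fst_le _)
  have h2 : ‖θ - ξ‖ ≤ ‖θ - θ₁‖ + ‖θ₁ - ξ‖ := by
    simpa using norm_add_le (θ - θ₁) (θ₁ - ξ)
  exact h1.trans (by linarith)

end Regular

end

noncomputable section

/-! ### Linear statistics of the residuals -/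

/-- The ordered pairs of distinct nodes. -/
abbrev Pair (n : ℕ) : Type := {q : Fin n × Fin n // q.1 ≠ q.2}

lemma sum_pair {n : ℕ} {E : Type*} [AddCommMonoid E] {f : Fin n → Fin n → E}
    (hf : ∀ i, f i i = 0) : ∑ q : Pair n, f q.1.1 q.1.2 = ∑ i, ∑ j, f i j := by
  rw [← Finset.sum_product', Finset.univ_product_univ,
    ← Finset.sum_subtype (Finset.univ.filter fun q : Fin n × Fin n => q.1 ≠ q.2) (by simp)
      (fun q : Fin n × Fin n => f q.1 q.2), Finset.sum_filter_of_ne]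
  rintro ⟨i, j⟩ - h hij
  dsimp only at h hij
  subst hij
  exact h (hf _)

variable {n p : ℕ} {Ω : Type*} [MeasurableSpace Ω] {P : Measure Ω}
  {A : Ω → Adj n} {Z : Fin n → Fin n → Fin p → ℝ} {η₀ : Idx n → ℝ} {γ₀ : Fin p → ℝ}

lemma resid_self (a : Adj n) (i : Fin n) : resid Z a η₀ γ₀ i i = 0 := by simp [resid]

lemma _root_.ProbabilityTheory.HasSubgaussianMGF.mono {X : Ω → ℝ} {c d : NNReal}
    (h : HasSubgaussianMGF X c P) (hcd : c ≤ d) : HasSubgaussianMGF X d P where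
  integrable_exp_mul := h.integrable_exp_mul
  mgf_le t := (h.mgf_le t).trans (by gcongr)

namespace IsModel

lemma measurable_entry (hA : IsModel P A Z η₀ γ₀) (i j : Fin n) : Measurable fun ω => A ω i j :=
  (measurable_pi_apply j).comp ((measurable_pi_apply i).comp hA.measurable)

lemma measurable_resid (hA : IsModel P A Z η₀ γ₀) (i j : Fin n) :
    Measurable fun ω => resid Z (A ω) η₀ γ₀ i j := by
  unfold resid
  exact (measurable_of_finite fun b : Bool =>
    if i = j then (0 : ℝ) else (if b = true then 1 else 0) - mu (linPred Z η₀ γ₀ i j)).comp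
    (hA.measurable_entry i j)

/-- The weighted residuals over distinct pairs are independent. -/
lemma iIndepFun_resid (hA : IsModel P A Z η₀ γ₀) (c : Fin n → Fin n → ℝ) :
    iIndepFun (fun (q : Pair n) ω =>
      c q.1.1 q.1.2 * resid Z (A ω) η₀ γ₀ q.1.1 q.1.2) P :=
  hA.indep.comp (fun q (b : Bool) => c q.1.1 q.1.2 * (if q.1.1 = q.1.2 then 0 else
    (if b = true then 1 else 0) - mu (linPred Z η₀ γ₀ q.1.1 q.1.2)))
    fun _ => measurable_of_finite _

variable [IsProbabilityMeasure P]

/-- Expectation of a function of a single edge indicator. -/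
lemma integral_entry (hA : IsModel P A Z η₀ γ₀) {i j : Fin n} (hij : i ≠ j)
    {E : Type*} [NormedAddCommGroup E] [NormedSpace ℝ E] [CompleteSpace E] (f : Bool → E) :
    ∫ ω, f (A ω i j) ∂P = mu (linPred Z η₀ γ₀ i j) • f true
      + (1 - mu (linPred Z η₀ γ₀ i j)) • f false := by
  have hs : MeasurableSet {ω | A ω i j = true} :=
    hA.measurable_entry i j (measurableSet_singleton true)
  have h1 : ∀ ω, f (A ω i j)
      = {ω | A ω i j = true}.indicator (fun _ => f true - f false) ω + f false := fun ω => by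
    by_cases h : A ω i j = true
    · rw [Set.indicator_of_mem (by exact h), h]; abel
    · rw [Set.indicator_of_notMem (by exact h), zero_add]
      rw [Bool.not_eq_true] at h; rw [h]
  simp only [h1]
  rw [integral_add ((integrable_const _).indicator hs) (integrable_const _),
    integral_indicator_const _ hs, integral_const, probReal_univ, Measure.real, hA.prob i j hij,
    ENNReal.toReal_ofReal (mu_pos _).le]
  module

/-- Hoeffding's lemma for a centred variable with range of length one. -/
lemma hasSubgaussianMGF_resid (hA : IsModel P A Z η₀ γ₀) {i j : Fin n} (hij : i ≠ j) :
    HasSubgaussianMGF (fun ω => resid Z (A ω) η₀ γ₀ i j) (1 / 4) P := by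
  have h := hasSubgaussianMGF_of_mem_Icc_of_integral_eq_zero (μ := P)
    (X := fun ω => resid Z (A ω) η₀ γ₀ i j) (a := -mu (linPred Z η₀ γ₀ i j))
    (b := 1 - mu (linPred Z η₀ γ₀ i j)) (hA.measurable_resid i j).aemeasurable
    (ae_of_all _ fun ω => by
      simp only [resid, if_neg hij]
      split_ifs <;> constructor <;> simp)
    (by
      simp only [resid, if_neg hij]
      rw [hA.integral_entry hij (fun b => (if b = true then (1 : ℝ) else 0)
        - mu (linPred Z η₀ γ₀ i j))]
      simp
      ring)
  convert h using 1
  rw [sub_neg_eq_add, sub_add_cancel, nnnorm_one]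
  norm_num

/-- Hoeffding's inequality for linear statistics of the residuals. -/
lemma measure_abs_sum_ge_le (hA : IsModel P A Z η₀ γ₀) {c : Fin n → Fin n → ℝ} {v t : ℝ}
    (hv : ∑ i, ∑ j, c i j ^ 2 ≤ v) (ht : 0 ≤ t) :
    P.real {ω | t ≤ |∑ i, ∑ j, c i j * resid Z (A ω) η₀ γ₀ i j|}
      ≤ 2 * Real.exp (-2 * t ^ 2 / v) := by
  have hv0 : 0 ≤ v := le_trans (by positivity) hv
  have h1 : HasSubgaussianMGF (fun ω => ∑ q : Pair n,
      c q.1.1 q.1.2 * resid Z (A ω) η₀ γ₀ q.1.1 q.1.2) (⟨v, hv0⟩ / 4) P := by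
    refine (HasSubgaussianMGF.sum_of_iIndepFun (hA.iIndepFun_resid c)
      fun q _ => (hA.hasSubgaussianMGF_resid q.2).const_mul (c q.1.1 q.1.2)).mono ?_
    rw [← NNReal.coe_le_coe, NNReal.coe_sum]
    change ∑ q : Pair n, c q.1.1 q.1.2 ^ 2 * (1 / 4) ≤ v / 4
    rw [← Finset.sum_mul]
    have : ∑ q : Pair n, c q.1.1 q.1.2 ^ 2 ≤ ∑ i, ∑ j, c i j ^ 2 := by
      have e1 := sum_pair (f := fun i j : Fin n => if i = j then 0 else c i j ^ 2) (by simp)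
      rw [Finset.sum_congr rfl fun q _ => if_neg q.2] at e1
      rw [e1]
      refine Finset.sum_le_sum fun i _ => Finset.sum_le_sum fun j _ => ?_
      split_ifs
      · positivity
      · exact le_rfl
    linarith
  have h2 : ∀ ω, ∑ q : Pair n, c q.1.1 q.1.2 * resid Z (A ω) η₀ γ₀ q.1.1 q.1.2
      = ∑ i, ∑ j, c i j * resid Z (A ω) η₀ γ₀ i j := fun ω =>
    sum_pair (f := fun i j => c i j * resid Z (A ω) η₀ γ₀ i j) (by simp [resid_self])
  simp only [h2] at h1
  have h3 := h1.measure_ge_le ht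
  have h4 := h1.neg.measure_ge_le ht
  have hexp : -t ^ 2 / (2 * ((⟨v, hv0⟩ / 4 : NNReal) : ℝ)) = -2 * t ^ 2 / v := by
    change -t ^ 2 / (2 * (v / 4)) = _
    -- For v = 0 both quotients are 0 by the convention for division by zero.
    rcases hv0.eq_or_lt with h0 | h0
    · simp [← h0]
    · field_simp; ring
  rw [hexp] at h3 h4
  refine (measureReal_mono (s₂ := {ω | t ≤ ∑ i, ∑ j, c i j * resid Z (A ω) η₀ γ₀ i j} ∪
    {ω | t ≤ (-fun ω => ∑ i, ∑ j, c i j * resid Z (A ω) η₀ γ₀ i j) ω}) ?_).trans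
    ((measureReal_union_le _ _).trans (by linarith))
  intro ω hω
  rcases le_abs.1 (show t ≤ |_| from hω) with h | h
  · exact Or.inl h
  · exact Or.inr h

/-- Simultaneous control of finitely many linear statistics of the residuals. -/
lemma measure_exists_abs_sum_ge_le (hA : IsModel P A Z η₀ γ₀) {ι : Type*} [Fintype ι]
    {c : ι → Fin n → Fin n → ℝ} {v : ι → ℝ} (hv0 : ∀ k, 0 < v k)
    (hv : ∀ k, ∑ i, ∑ j, c k i j ^ 2 ≤ v k) {L : ℝ} (hL : 0 ≤ L) :
    P.real {ω | ∃ k, √(v k * L) ≤ |∑ i, ∑ j, c k i j * resid Z (A ω) η₀ γ₀ i j|}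
      ≤ Fintype.card ι * (2 * Real.exp (-2 * L)) := by
  have h1 : {ω | ∃ k, √(v k * L) ≤ |∑ i, ∑ j, c k i j * resid Z (A ω) η₀ γ₀ i j|}
      = ⋃ k, {ω | √(v k * L) ≤ |∑ i, ∑ j, c k i j * resid Z (A ω) η₀ γ₀ i j|} := by
    ext; simp
  rw [h1]
  refine (measureReal_iUnion_fintype_le _).trans ?_
  refine (Finset.sum_le_sum (g := fun _ => 2 * Real.exp (-2 * L)) fun k _ => ?_).trans
    (by simp)
  refine (hA.measure_abs_sum_ge_le (hv k) (Real.sqrt_nonneg _)).trans (le_of_eq ?_)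
  have := hv0 k
  rw [Real.sq_sqrt (by positivity)]
  congr 2
  field_simp

end IsModel

/-! ### Characteristic functions of linear statistics -/

/-- Factors are exchanged one at a time, the remaining ones having norm at most 1. -/
lemma norm_prod_sub_prod_le {ι : Type*} (s : Finset ι) {f g : ι → ℂ} (hf : ∀ i ∈ s, ‖f i‖ ≤ 1)
    (hg : ∀ i ∈ s, ‖g i‖ ≤ 1) : ‖∏ i ∈ s, f i - ∏ i ∈ s, g i‖ ≤ ∑ i ∈ s, ‖f i - g i‖ := by
  classical
  induction s using Finset.induction_on with
  | empty => simp
  | insert a s ha ih =>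
    rw [Finset.prod_insert ha, Finset.prod_insert ha, Finset.sum_insert ha]
    have h1 : f a * ∏ i ∈ s, f i - g a * ∏ i ∈ s, g i
        = (f a - g a) * ∏ i ∈ s, f i + g a * (∏ i ∈ s, f i - ∏ i ∈ s, g i) := by ring
    rw [h1]
    refine (norm_add_le _ _).trans (add_le_add ?_ ?_)
    · rw [norm_mul]
      refine mul_le_of_le_one_right (norm_nonneg _) ?_
      rw [norm_prod]
      exact Finset.prod_le_one (fun _ _ => norm_nonneg _)
        fun i hi => hf i (Finset.mem_insert_of_mem hi)
    · rw [norm_mul]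
      refine (mul_le_of_le_one_left (norm_nonneg _) (hg a (Finset.mem_insert_self _ _))).trans
        (ih (fun i hi => hf i (Finset.mem_insert_of_mem hi))
          fun i hi => hg i (Finset.mem_insert_of_mem hi))

lemma norm_exp_I_mul_sub_le {x : ℝ} (hx : |x| ≤ 1) :
    ‖Complex.exp (x * Complex.I) - (1 + x * Complex.I - x ^ 2 / 2)‖ ≤ |x| ^ 3 := by
  have hn : ‖(x : ℂ) * Complex.I‖ = |x| := by simp
  have h := Complex.exp_bound (x := x * Complex.I) (by rw [hn]; exact hx) (n := 3) (by norm_num)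
  rw [hn] at h
  simp only [Finset.sum_range_succ, Finset.sum_range_zero, mul_pow, Complex.I_sq] at h
  have h3 : 0 ≤ |x| ^ 3 := by positivity
  refine le_trans (le_of_eq ?_) (h.trans ?_)
  · congr 1
    simp [Nat.factorial]
    ring
  · norm_num [Nat.factorial]
    linarith

/-- The characteristic function of a centered Bernoulli variable is close to that of a normal
variable with the same variance. -/
lemma norm_bernoulli_charFun_sub_le {m c : ℝ} (hm0 : 0 ≤ m) (hm1 : m ≤ 1) (hc : |c| ≤ 1) :
    ‖(m • Complex.exp ((c * (1 - m) : ℝ) * Complex.I)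
        + (1 - m) • Complex.exp ((c * (0 - m) : ℝ) * Complex.I))
      - Complex.exp ((-(c ^ 2 * (m * (1 - m)) / 2) : ℝ) : ℂ)‖
      ≤ 2 * (|c| * (c ^ 2 * (m * (1 - m)))) := by
  have hu0 : 0 ≤ m * (1 - m) := mul_nonneg hm0 (by linarith)
  have hu1 : m * (1 - m) ≤ 1 / 4 := by nlinarith [sq_nonneg (m - 1 / 2)]
  have hc2 : c ^ 2 ≤ 1 := by rw [← sq_abs]; nlinarith [abs_nonneg c]
  have ha : |c * (1 - m)| = |c| * (1 - m) := by
    rw [abs_mul, abs_of_nonneg (by linarith : 0 ≤ 1 - m)]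
  have hb : |c * (0 - m)| = |c| * m := by
    rw [abs_mul, zero_sub, abs_neg, abs_of_nonneg hm0]
  have h1 := norm_exp_I_mul_sub_le (x := c * (1 - m)) (by rw [ha]; nlinarith [abs_nonneg c])
  have h2 := norm_exp_I_mul_sub_le (x := c * (0 - m)) (by rw [hb]; nlinarith [abs_nonneg c])
  rw [ha] at h1
  rw [hb] at h2
  set s := c ^ 2 * (m * (1 - m)) / 2 with hs
  have hs0 : 0 ≤ s := by positivity
  have hs1 : s ≤ 1 / 8 := by rw [hs]; nlinarith
  have h3 : ‖Complex.exp ((-s : ℝ) : ℂ) - (1 - s)‖ ≤ s ^ 2 := by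
    have e := Real.abs_exp_sub_one_sub_id_le (x := -s)
      (by rw [abs_neg, abs_of_nonneg hs0]; linarith)
    rw [← Complex.ofReal_exp]
    have e2 : ((Real.exp (-s) : ℝ) : ℂ) - (1 - s) = ((Real.exp (-s) - 1 - (-s) : ℝ) : ℂ) := by
      push_cast; ring
    rw [e2, Complex.norm_real, Real.norm_eq_abs]
    simpa using e
  set a : ℂ := Complex.exp ((c * (1 - m) : ℝ) * Complex.I)
  set b : ℂ := Complex.exp ((c * (0 - m) : ℝ) * Complex.I)
  -- The linear terms cancel because the variable is centred, and the quadratic ones add up to s;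
  -- only the cubic errors and s² remain.
  have key : m • a + (1 - m) • b - Complex.exp ((-s : ℝ) : ℂ)
      = (m • (a - (1 + ((c * (1 - m) : ℝ) : ℂ) * Complex.I - ((c * (1 - m) : ℝ) : ℂ) ^ 2 / 2))
        + (1 - m) • (b - (1 + ((c * (0 - m) : ℝ) : ℂ) * Complex.I
          - ((c * (0 - m) : ℝ) : ℂ) ^ 2 / 2)))
        - (Complex.exp ((-s : ℝ) : ℂ) - (1 - s)) := by
    rw [hs]
    simp only [Complex.real_smul]
    push_cast
    ring
  rw [key]
  refine (norm_sub_le _ _).trans ((add_le_add (norm_add_le _ _) h3).trans ?_)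
  rw [norm_smul, norm_smul, Real.norm_eq_abs, Real.norm_eq_abs, abs_of_nonneg hm0,
    abs_of_nonneg (by linarith : 0 ≤ 1 - m)]
  have e1 := mul_le_mul_of_nonneg_left h1 hm0
  have e2 := mul_le_mul_of_nonneg_left h2 (by linarith : 0 ≤ 1 - m)
  have e3 : m * (|c| * (1 - m)) ^ 3 + (1 - m) * (|c| * m) ^ 3
      ≤ |c| * (c ^ 2 * (m * (1 - m))) := by
    have : m * (|c| * (1 - m)) ^ 3 + (1 - m) * (|c| * m) ^ 3
      = |c| * (|c| ^ 2 * (m * (1 - m))) * ((1 - m) ^ 2 + m ^ 2) := by ring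
    rw [this, sq_abs]
    refine mul_le_of_le_one_right (by positivity) (by nlinarith)
  have e4 : s ^ 2 ≤ |c| * (c ^ 2 * (m * (1 - m))) := by
    have e5 : s ^ 2 = |c| * (c ^ 2 * (m * (1 - m))) * (|c| * (m * (1 - m)) / 4) := by
      rw [hs, ← sq_abs c]; ring
    rw [e5]
    refine mul_le_of_le_one_right (by positivity) ?_
    nlinarith [abs_nonneg c]
  linarith

/-- Independence factorizes the characteristic function, and each pair contributes an error of at
most 2|c_ij| times its variance c_ij²u_ij. Uniformly small weights thus suffice for normality. -/
lemma IsModel.norm_charFun_sub_le [IsProbabilityMeasure P] (hA : IsModel P A Z η₀ γ₀)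
    {c : Fin n → Fin n → ℝ} {ε : ℝ} (hc : ∀ i j, i ≠ j → |c i j| ≤ ε) (hε : ε ≤ 1) :
    ‖∫ ω, Complex.exp ((∑ i, ∑ j, c i j * resid Z (A ω) η₀ γ₀ i j : ℝ) * Complex.I) ∂P
        - Complex.exp ((-(∑ i, ∑ j, c i j ^ 2 * u Z η₀ γ₀ i j) / 2 : ℝ) : ℂ)‖
      ≤ 2 * ε * ∑ i, ∑ j, c i j ^ 2 * u Z η₀ γ₀ i j := by
  have h2 : ∀ ω, Complex.exp ((∑ i, ∑ j, c i j * resid Z (A ω) η₀ γ₀ i j : ℝ) * Complex.I)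
      = ∏ q : Pair n, Complex.exp (((c q.1.1 q.1.2 * resid Z (A ω) η₀ γ₀ q.1.1 q.1.2 : ℝ) : ℂ)
        * Complex.I) := fun ω => by
    rw [← sum_pair (f := fun i j => c i j * resid Z (A ω) η₀ γ₀ i j) (by simp [resid_self]),
      Complex.ofReal_sum, Finset.sum_mul, Complex.exp_sum]
  have h3 : ∑ i, ∑ j, c i j ^ 2 * u Z η₀ γ₀ i j
      = ∑ q : Pair n, c q.1.1 q.1.2 ^ 2 * u Z η₀ γ₀ q.1.1 q.1.2 :=
    (sum_pair (f := fun i j => c i j ^ 2 * u Z η₀ γ₀ i j) (by simp [u_self])).symm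
  have h4 : Complex.exp ((-(∑ i, ∑ j, c i j ^ 2 * u Z η₀ γ₀ i j) / 2 : ℝ) : ℂ)
      = ∏ q : Pair n, Complex.exp ((-(c q.1.1 q.1.2 ^ 2 * u Z η₀ γ₀ q.1.1 q.1.2 / 2) : ℝ) : ℂ) := by
    rw [h3, ← Complex.exp_sum, ← Complex.ofReal_sum]
    congr 2
    rw [Finset.sum_neg_distrib, neg_div, Finset.sum_div]
  simp only [h2]
  rw [h4, (hA.iIndepFun_resid c).integral_fun_prod_comp
    (f := fun _ (x : ℝ) => Complex.exp ((x : ℂ) * Complex.I))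
    (fun q => ((hA.measurable_resid q.1.1 q.1.2).const_mul _).aemeasurable)
    (fun q => by fun_prop)]
  have hterm : ∀ q : Pair n,
      ‖∫ ω, Complex.exp (((c q.1.1 q.1.2 * resid Z (A ω) η₀ γ₀ q.1.1 q.1.2 : ℝ) : ℂ) * Complex.I) ∂P
        - Complex.exp ((-(c q.1.1 q.1.2 ^ 2 * u Z η₀ γ₀ q.1.1 q.1.2 / 2) : ℝ) : ℂ)‖
      ≤ 2 * ε * (c q.1.1 q.1.2 ^ 2 * u Z η₀ γ₀ q.1.1 q.1.2) := fun q => by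
    simp only [resid, u, if_neg q.2]
    set m := mu (linPred Z η₀ γ₀ q.1.1 q.1.2) with hm
    rw [hA.integral_entry q.2 (fun b => Complex.exp (((c q.1.1 q.1.2
      * ((if b = true then 1 else 0) - m) : ℝ) : ℂ) * Complex.I)), muDeriv_eq_mu_mul, ← hm]
    have e := norm_bernoulli_charFun_sub_le (m := m) (c := c q.1.1 q.1.2) (mu_pos _).le
      (mu_lt_one _).le ((hc _ _ q.2).trans hε)
    simp only [if_true, Bool.false_eq_true, if_false]
    refine e.trans ?_
    rw [mul_assoc]
    have : 0 ≤ m * (1 - m) := mul_nonneg (mu_pos _).le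
      (by linarith [mu_lt_one (linPred Z η₀ γ₀ q.1.1 q.1.2)])
    have := hc _ _ q.2
    gcongr
  refine (norm_prod_sub_prod_le _ (fun q _ => ?_) (fun q _ => ?_)).trans ?_
  · refine (norm_integral_le_integral_norm _).trans ?_
    simp only [Complex.norm_exp_ofReal_mul_I, integral_const, probReal_univ, smul_eq_mul, mul_one,
      le_refl]
  · rw [← Complex.ofReal_exp, Complex.norm_real, Real.norm_eq_abs, Real.abs_exp,
      Real.exp_le_one_iff]
    have := u_nonneg (Z := Z) (η₀ := η₀) (γ₀ := γ₀) q.1.1 q.1.2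
    have : 0 ≤ c q.1.1 q.1.2 ^ 2 * u Z η₀ γ₀ q.1.1 q.1.2 / 2 := by positivity
    linarith
  · rw [h3, Finset.mul_sum]
    exact Finset.sum_le_sum fun q _ => hterm q

end

noncomputable section

variable {n p : ℕ} {Ω : Type*} [MeasurableSpace Ω] {P : Measure Ω} [IsProbabilityMeasure P]
  {A : Ω → Adj n} {Z : Fin n → Fin n → Fin p → ℝ} {η₀ : Idx n → ℝ} {γ₀ : Fin p → ℝ}

/-! ### The exceptional event -/

/-- The centred covariate weights: the entries of the covariates minus their weighted row and
column means. -/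
def covWeight (Z : Fin n → Fin n → Fin p → ℝ) (η₀ : Idx n → ℝ) (γ₀ : Fin p → ℝ) (l : Fin p)
    (i j : Fin n) : ℝ :=
  (if i = j then 0 else Z i j l) - (∑ k, u Z η₀ γ₀ i k * Z i k l) / uRow Z η₀ γ₀ i
    - (∑ k, u Z η₀ γ₀ k j * Z k j l) / uCol Z η₀ γ₀ j

/-- Exchanging summations moves the centring from the residuals to the covariates, so the covariate
defect is a linear statistic with bounded weights, to which Hoeffding's inequality applies. -/
lemma sum_covWeight_mul {X : Fin n → Fin n → ℝ} (hX : ∀ i, X i i = 0) (l : Fin p) :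
    ∑ i, ∑ j, covWeight Z η₀ γ₀ l i j * X i j
      = ∑ i, ∑ j, (X i j - u Z η₀ γ₀ i j * ((∑ k, X i k) / uRow Z η₀ γ₀ i
        + (∑ k, X k j) / uCol Z η₀ γ₀ j)) * Z i j l := by
  have h1 : ∑ i, ∑ j, (∑ k, u Z η₀ γ₀ i k * Z i k l) / uRow Z η₀ γ₀ i * X i j
      = ∑ i, ∑ j, u Z η₀ γ₀ i j * ((∑ k, X i k) / uRow Z η₀ γ₀ i) * Z i j l := by
    refine Finset.sum_congr rfl fun i _ => ?_
    rw [← Finset.mul_sum, div_mul_eq_mul_div, ← mul_div_assoc', Finset.sum_mul]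
    exact Finset.sum_congr rfl fun j _ => by ring
  have h2 : ∑ i, ∑ j, (∑ k, u Z η₀ γ₀ k j * Z k j l) / uCol Z η₀ γ₀ j * X i j
      = ∑ i, ∑ j, u Z η₀ γ₀ i j * ((∑ k, X k j) / uCol Z η₀ γ₀ j) * Z i j l := by
    rw [Finset.sum_comm]
    conv_rhs => rw [Finset.sum_comm]
    refine Finset.sum_congr rfl fun j _ => ?_
    rw [← Finset.mul_sum, div_mul_eq_mul_div, ← mul_div_assoc', Finset.sum_mul]
    exact Finset.sum_congr rfl fun i _ => by ring
  have h3 : ∀ i j, (if i = j then 0 else Z i j l) * X i j = X i j * Z i j l := fun i j => by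
    split_ifs with h
    · subst h; simp [hX]
    · ring
  simp only [covWeight, sub_mul, mul_add, add_mul, Finset.sum_sub_distrib, Finset.sum_add_distrib,
    h1, h2, h3]
  ring

namespace Regular

variable {B M κ : ℝ}

lemma abs_covWeight_le (h : Regular Z η₀ γ₀ B M κ) (l : Fin p) (i j : Fin n) :
    |covWeight Z η₀ γ₀ l i j| ≤ 3 * M := by
  have hM := h.M_ge
  have h1 := abs_sum_u_mul_le (Z := Z) (η₀ := η₀) (γ₀ := γ₀) (g := fun i j => Z i j l)
    (fun i j hij => h.Z_le i j hij l)
  have h2 : |(∑ k, u Z η₀ γ₀ i k * Z i k l) / uRow Z η₀ γ₀ i| ≤ M := by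
    rw [abs_div, abs_of_pos (h.uRow_pos i), div_le_iff₀ (h.uRow_pos i)]
    exact (h1 i).1
  have h3 : |(∑ k, u Z η₀ γ₀ k j * Z k j l) / uCol Z η₀ γ₀ j| ≤ M := by
    rw [abs_div, abs_of_pos (h.uCol_pos j), div_le_iff₀ (h.uCol_pos j)]
    exact (h1 j).2
  have h4 : |if i = j then 0 else Z i j l| ≤ M := by
    split_ifs with hij
    · simp; linarith
    · exact h.Z_le i j hij l
  unfold covWeight
  refine (abs_sub _ _).trans ?_
  linarith [abs_sub (if i = j then 0 else Z i j l)
    ((∑ k, u Z η₀ γ₀ i k * Z i k l) / uRow Z η₀ γ₀ i)]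

lemma sum_sq_le {c : Fin n → Fin n → ℝ} {C : ℝ} (hc : ∀ i j, |c i j| ≤ C) :
    ∑ i, ∑ j, c i j ^ 2 ≤ C ^ 2 * (n : ℝ) ^ 2 :=
  (le_abs_self _).trans (sum_sum_le_sq fun i j => by
    rw [abs_of_nonneg (sq_nonneg _), ← sq_abs]
    exact pow_le_pow_left₀ (abs_nonneg _) (hc i j) 2)

lemma abs_u_div_le (h : Regular Z η₀ γ₀ B M κ) {x : ℝ} (hx : n / (2 * B) ≤ x) (i j : Fin n) :
    |u Z η₀ γ₀ i j / x| ≤ B / (2 * n) := by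
  have hB := h.B_pos
  have hn := h.n_pos
  have hx0 : 0 < x := lt_of_lt_of_le (by positivity) hx
  rw [abs_of_nonneg (div_nonneg (u_nonneg i j) hx0.le), div_le_iff₀ hx0]
  calc u Z η₀ γ₀ i j ≤ 1 / 4 := u_le i j
    _ = B / (2 * n) * (n / (2 * B)) := by field_simp; norm_num
    _ ≤ _ := by gcongr

/-- With high probability the maximum likelihood estimate exists and the outgoingness estimates
are close to their linear approximation. -/
theorem measure_bad_le (h : Regular Z η₀ γ₀ B M κ) (hA : IsModel P A Z η₀ γ₀)
    {last : Fin n} (hlast : (last : ℕ) = n - 1) {s r Λ : ℝ} (hs : s = √(Real.log n))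
    (hΛ : Λ = 10 * p * M ^ 2 * κ * B ^ 2)
    (hr_def : r = 2 * (2 * (2 * B * s / √n) + Λ * (B ^ 2 * s / n)))
    (hr : (2 + p * M) * r ≤ 1) (hrΛ : Λ * (2 * (2 + p * M) ^ 2 * r) ≤ 1 / 2) :
    P.real {ω | ¬ ((∃ η γ, IsMLE Z (A ω) η γ) ∧ ∀ η γ, IsMLE Z (A ω) η γ → ∀ i,
      |η (Sum.inl i) - η₀ (Sum.inl i) - ((∑ j, resid Z (A ω) η₀ γ₀ i j) / uRow Z η₀ γ₀ i
          + (∑ k, resid Z (A ω) η₀ γ₀ k last) / uCol Z η₀ γ₀ last)|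
        ≤ Λ * (B ^ 2 * s / n) + Λ * (2 * (2 + p * M) ^ 2 * r) * r)}
      ≤ (4 * n + p) * (2 * Real.exp (-2 * Real.log n)) := by
  have hB := h.B_pos
  have hB4 := h.B_ge
  have hM := h.M_ge
  have hn := h.n_pos
  have hn1 : (1 : ℝ) ≤ n := by exact_mod_cast (by have := h.four_le; omega : 1 ≤ n)
  have hlog : 0 ≤ Real.log n := Real.log_nonneg hn1
  have hs0 : 0 ≤ s := by rw [hs]; positivity
  -- The 4n + p statistics to be controlled: row sums, column sums, weighted sums of the G_j along
  -- rows and of the F_i along columns, and the centred covariate sums.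
  let c : (Fin n ⊕ Fin n) ⊕ ((Fin n ⊕ Fin n) ⊕ Fin p) → Fin n → Fin n → ℝ :=
    Sum.elim (Sum.elim (fun a i _ => if a = i then 1 else 0) (fun a _ j => if a = j then 1 else 0))
      (Sum.elim (Sum.elim (fun a _ j => u Z η₀ γ₀ a j / uCol Z η₀ γ₀ j)
        (fun a i _ => u Z η₀ γ₀ i a / uRow Z η₀ γ₀ i)) (covWeight Z η₀ γ₀))
  -- The averaged statistics spread weights of size B/(2n) over n² residuals, so their variance
  -- proxy (B/2)² does not grow with n at fixed B, unlike the proxy n of a row sum. This is the gain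
  -- of √n.
  let v : (Fin n ⊕ Fin n) ⊕ ((Fin n ⊕ Fin n) ⊕ Fin p) → ℝ :=
    Sum.elim (fun _ => n) (Sum.elim (fun _ => (B / 2) ^ 2) (fun _ => (3 * M * n) ^ 2))
  have hv0 : ∀ k, 0 < v k := by
    rintro (k | k | k)
    · exact hn
    · change 0 < (B / 2) ^ 2; positivity
    · change 0 < (3 * M * n) ^ 2; positivity
  have hBn : (B / (2 * n)) ^ 2 * (n : ℝ) ^ 2 = (B / 2) ^ 2 := by field_simp
  have hv : ∀ k, ∑ i, ∑ j, c k i j ^ 2 ≤ v k := by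
    rintro ((k | k) | (k | k) | k)
    · simp [c, v]
    · simp [c, v]
    · exact (sum_sq_le fun i j => h.abs_u_div_le (h.uCol_ge j) k j).trans hBn.le
    · exact (sum_sq_le fun i j => h.abs_u_div_le (h.uRow_ge i) i k).trans hBn.le
    · refine (sum_sq_le fun i j => h.abs_covWeight_le k i j).trans (le_of_eq ?_)
      change _ = (3 * M * n) ^ 2
      ring
  have key := hA.measure_exists_abs_sum_ge_le hv0 hv hlog
  have hcard : ((Fintype.card ((Fin n ⊕ Fin n) ⊕ ((Fin n ⊕ Fin n) ⊕ Fin p)) : ℕ) : ℝ)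
      = 4 * n + p := by
    simp only [Fintype.card_sum, Fintype.card_fin]
    push_cast
    ring
  rw [hcard] at key
  refine (measureReal_mono ?_).trans key
  intro ω hω
  by_contra hgood
  refine hω ?_
  simp only [Set.mem_ofPred_eq, not_exists, not_le] at hgood
  set X := resid Z (A ω) η₀ γ₀ with hX
  have hsn : √(n * Real.log n) = √n * s := by rw [hs, Real.sqrt_mul hn.le]
  have hsB : √((B / 2) ^ 2 * Real.log n) = B / 2 * s := by
    rw [hs, Real.sqrt_mul (by positivity), Real.sqrt_sq (by positivity)]
  have hsM : √((3 * M * n) ^ 2 * Real.log n) = 3 * M * n * s := by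
    rw [hs, Real.sqrt_mul (by positivity), Real.sqrt_sq (by positivity)]
  have hsq : √(n : ℝ) * √n = n := Real.mul_self_sqrt hn.le
  have hsqp : 0 < √(n : ℝ) := Real.sqrt_pos.2 hn
  -- τ and δ are the Hoeffding thresholds √n s and Bs/2 divided by n/(2B), the lower bound for all
  -- row and column sums of u.
  have hτ : √n * s = 2 * B * s / √n * (n / (2 * B)) := by
    field_simp
    linear_combination s * hsq
  have hδ : B / 2 * s = B ^ 2 * s / n * (n / (2 * B)) := by field_simp
  refine h.mle_expansion (A ω) hX (F := fun i => (∑ j, X i j) / uRow Z η₀ γ₀ i)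
    (G := fun j => (∑ i, X i j) / uCol Z η₀ γ₀ j) (fun _ => rfl) (fun _ => rfl) hlast
    (τ := 2 * B * s / √n) (δ := B ^ 2 * s / n) hΛ ?_ ?_ ?_ ?_ ?_ (by rw [hr_def]; linarith) hr hrΛ
  · intro i
    have e := hgood (Sum.inl (Sum.inl i))
    simp only [c, v, Sum.elim_inl, ite_mul, one_mul, zero_mul] at e
    rw [hsn, Finset.sum_comm] at e
    simp only [Finset.sum_ite_eq, Finset.mem_univ, if_true] at e
    rw [abs_div, abs_of_pos (h.uRow_pos i), div_le_iff₀ (h.uRow_pos i)]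
    refine e.le.trans (hτ.le.trans ?_)
    exact mul_le_mul_of_nonneg_left (h.uRow_ge i) (by positivity)
  · intro j
    have e := hgood (Sum.inl (Sum.inr j))
    simp only [c, v, Sum.elim_inl, Sum.elim_inr, ite_mul, one_mul, zero_mul] at e
    rw [hsn] at e
    simp only [Finset.sum_ite_eq, Finset.mem_univ, if_true] at e
    rw [abs_div, abs_of_pos (h.uCol_pos j), div_le_iff₀ (h.uCol_pos j)]
    refine e.le.trans (hτ.le.trans ?_)
    exact mul_le_mul_of_nonneg_left (h.uCol_ge j) (by positivity)
  · intro i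
    have e := hgood (Sum.inr (Sum.inl (Sum.inl i)))
    simp only [c, v, Sum.elim_inl, Sum.elim_inr] at e
    rw [hsB, Finset.sum_comm] at e
    have e1 : ∑ j, u Z η₀ γ₀ i j * ((∑ i, X i j) / uCol Z η₀ γ₀ j)
        = ∑ j, ∑ k, u Z η₀ γ₀ i j / uCol Z η₀ γ₀ j * X k j :=
      Finset.sum_congr rfl fun j _ => by rw [← Finset.mul_sum]; ring
    rw [e1]
    refine e.le.trans (hδ.le.trans ?_)
    exact mul_le_mul_of_nonneg_left (h.uRow_ge i) (by positivity)
  · intro j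
    have e := hgood (Sum.inr (Sum.inl (Sum.inr j)))
    simp only [c, v, Sum.elim_inl, Sum.elim_inr] at e
    rw [hsB] at e
    have e1 : ∑ i, u Z η₀ γ₀ i j * ((∑ j, X i j) / uRow Z η₀ γ₀ i)
        = ∑ i, ∑ k, u Z η₀ γ₀ i j / uRow Z η₀ γ₀ i * X i k :=
      Finset.sum_congr rfl fun j _ => by rw [← Finset.mul_sum]; ring
    rw [e1]
    refine e.le.trans (hδ.le.trans ?_)
    exact mul_le_mul_of_nonneg_left (h.uCol_ge j) (by positivity)
  · intro l
    have e := hgood (Sum.inr (Sum.inr l))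
    simp only [c, v, Sum.elim_inr] at e
    rw [hsM, sum_covWeight_mul (fun i => resid_self _ i)] at e
    refine e.le.trans ?_
    have e2 : M * (B ^ 2 * s / n) * (n : ℝ) ^ 2 = M * n * s * B ^ 2 := by field_simp
    rw [e2]
    have hMns : 0 ≤ M * n * s := by positivity
    calc 3 * M * n * s = M * n * s * 3 := by ring
      _ ≤ M * n * s * B ^ 2 := mul_le_mul_of_nonneg_left (by nlinarith) hMns

end Regular

end

noncomputable section

/-! ### The covariance block and its square root -/

section Sqrt

variable {k : ℕ} {C : Matrix (Fin k) (Fin k) ℝ}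

lemma transpose_inv_sqrt (C : Matrix (Fin k) (Fin k) ℝ) :
    ((CFC.sqrt C)⁻¹)ᵀ = (CFC.sqrt C)⁻¹ := by
  have h : (CFC.sqrt C).IsHermitian :=
    (Matrix.nonneg_iff_posSemidef.1 (CFC.sqrt_nonneg C)).isHermitian
  rw [Matrix.transpose_nonsing_inv, ← Matrix.conjTranspose_eq_transpose_of_trivial, h.eq]

lemma dotProduct_inv_sqrt_mulVec (x t : Fin k → ℝ) :
    t ⬝ᵥ ((CFC.sqrt C)⁻¹ *ᵥ x) = ((CFC.sqrt C)⁻¹ *ᵥ t) ⬝ᵥ x := by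
  rw [Matrix.dotProduct_mulVec, ← Matrix.mulVec_transpose, transpose_inv_sqrt]

/-- The quadratic form of `C` at `C^{-1/2} t` is the squared length of `t`. -/
lemma dotProduct_mulVec_inv_sqrt (hC : C.PosDef) (t : Fin k → ℝ) :
    ((CFC.sqrt C)⁻¹ *ᵥ t) ⬝ᵥ (C *ᵥ ((CFC.sqrt C)⁻¹ *ᵥ t)) = t ⬝ᵥ t := by
  have h1 : CFC.sqrt C * CFC.sqrt C = C :=
    CFC.sqrt_mul_sqrt_self C (Matrix.nonneg_iff_posSemidef.2 hC.posSemidef)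
  have hdet : IsUnit (CFC.sqrt C).det := by
    have h2 := hC.det_pos
    rw [← h1, Matrix.det_mul] at h2
    exact (left_ne_zero_of_mul h2.ne').isUnit
  have h3 : C *ᵥ ((CFC.sqrt C)⁻¹ *ᵥ t) = CFC.sqrt C *ᵥ t := by
    rw [Matrix.mulVec_mulVec]
    congr 1
    nth_rewrite 1 [← h1]
    rw [Matrix.mul_assoc, Matrix.mul_nonsing_inv _ hdet, Matrix.mul_one]
  rw [h3, ← dotProduct_inv_sqrt_mulVec, Matrix.mulVec_mulVec, Matrix.nonsing_inv_mul _ hdet,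
    Matrix.one_mulVec]

end Sqrt

variable {n p k : ℕ} {Z : Fin n → Fin n → Fin p → ℝ} {η₀ : Idx n → ℝ} {γ₀ : Fin p → ℝ}
  {B M κ : ℝ}

lemma uLast_eq {last : Fin n} (hlast : (last : ℕ) = n - 1) :
    uLast Z η₀ γ₀ = uCol Z η₀ γ₀ last := by
  unfold uLast
  rw [dif_pos last.pos]
  congr 1
  exact Fin.ext hlast.symm

lemma upperLeft_S_mulVec {last : Fin n} (hlast : (last : ℕ) = n - 1) (hk : k ≤ n)
    (x : Fin k → ℝ) (a : Fin k) : (upperLeft k (S Z η₀ γ₀) *ᵥ x) a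
      = x a / uRow Z η₀ γ₀ (Fin.castLE hk a) + (∑ b, x b) / uCol Z η₀ γ₀ last := by
  simp only [Matrix.mulVec, dotProduct, upperLeft, S, Matrix.of_apply, dif_pos hk,
    Matrix.fromBlocks_apply₁₁, uLast_eq hlast, add_mul, Finset.sum_add_distrib, ← Finset.mul_sum,
    Fin.castLE_inj, ite_mul, zero_mul, Finset.sum_ite_eq, Finset.mem_univ, if_true]
  ring

lemma dotProduct_upperLeft_S_mulVec {last : Fin n} (hlast : (last : ℕ) = n - 1) (hk : k ≤ n)
    (x : Fin k → ℝ) : x ⬝ᵥ (upperLeft k (S Z η₀ γ₀) *ᵥ x)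
      = ∑ a, x a ^ 2 / uRow Z η₀ γ₀ (Fin.castLE hk a) + (∑ a, x a) ^ 2 / uCol Z η₀ γ₀ last := by
  simp only [dotProduct, upperLeft_S_mulVec hlast hk, mul_add, Finset.sum_add_distrib,
    ← Finset.sum_mul]
  congr 1
  · exact Finset.sum_congr rfl fun a _ => by ring
  · ring

lemma Regular.posDef_upperLeft_S (h : Regular Z η₀ γ₀ B M κ) (hk : k ≤ n) :
    (upperLeft k (S Z η₀ γ₀)).PosDef := by
  have hn := h.four_le
  refine Matrix.PosDef.of_dotProduct_mulVec_pos ?_ fun x hx => ?_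
  · ext a b
    simp only [Matrix.conjTranspose_apply, upperLeft, S, Matrix.of_apply, dif_pos hk,
      Matrix.fromBlocks_apply₁₁, star_trivial]
    by_cases hab : a = b
    · rw [hab]
    · rw [if_neg (by simpa using Ne.symm hab), if_neg (by simpa using hab)]
  · rw [star_trivial, dotProduct_upperLeft_S_mulVec (last := ⟨n - 1, by omega⟩) rfl hk]
    obtain ⟨a, ha⟩ := Function.ne_iff.1 hx
    have h1 : 0 < ∑ a, x a ^ 2 / uRow Z η₀ γ₀ (Fin.castLE hk a) :=
      Finset.sum_pos' (fun b _ => div_nonneg (sq_nonneg _) (h.uRow_pos _).le)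
        ⟨a, Finset.mem_univ _, div_pos (by have : x a ≠ 0 := ha; positivity) (h.uRow_pos _)⟩
    have h2 := div_nonneg (sq_nonneg (∑ a, x a)) (h.uCol_pos ⟨n - 1, by omega⟩).le
    linarith

lemma uRow_le (i : Fin n) : uRow Z η₀ γ₀ i ≤ n / 4 := by
  refine (Finset.sum_le_sum fun j _ => u_le i j).trans (le_of_eq ?_)
  simp
  ring

/-- The coordinates of a vector in terms of the quadratic form of the covariance block. -/
lemma Regular.sum_abs_le (h : Regular Z η₀ γ₀ B M κ) (hk : k ≤ n) {x : Fin k → ℝ} {N : ℝ}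
    (hN : 0 ≤ N) (hx : x ⬝ᵥ (upperLeft k (S Z η₀ γ₀) *ᵥ x) = N ^ 2) :
    ∑ a, |x a| ≤ k * N * √n := by
  have hn := h.four_le
  have hn0 := h.n_pos
  rw [dotProduct_upperLeft_S_mulVec (last := ⟨n - 1, by omega⟩) rfl hk] at hx
  have h2 := div_nonneg (sq_nonneg (∑ a, x a)) (h.uCol_pos ⟨n - 1, by omega⟩).le
  refine (Finset.sum_le_sum (g := fun _ => N * √n) fun a _ => ?_).trans
    (le_of_eq (by simp; ring))
  -- Only one of the nonnegative terms of the quadratic form is kept.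
  have h3 : x a ^ 2 / uRow Z η₀ γ₀ (Fin.castLE hk a) ≤ N ^ 2 := by
    have := Finset.single_le_sum (f := fun a => x a ^ 2 / uRow Z η₀ γ₀ (Fin.castLE hk a))
      (fun b _ => div_nonneg (sq_nonneg _) (h.uRow_pos _).le) (Finset.mem_univ a)
    linarith
  rw [div_le_iff₀ (h.uRow_pos _)] at h3
  have h4 : x a ^ 2 ≤ (N * √n) ^ 2 := by
    rw [mul_pow, Real.sq_sqrt hn0.le]
    refine h3.trans (mul_le_mul_of_nonneg_left ((uRow_le _).trans (by linarith)) (sq_nonneg _))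
  exact abs_le_of_sq_le_sq h4 (by positivity)

/-! ### The normal approximation -/

/-- The weights of the linear approximation to `∑ a, x a * (α̂_a - α_a)`. -/
def linWeight (Z : Fin n → Fin n → Fin p → ℝ) (η₀ : Idx n → ℝ) (γ₀ : Fin p → ℝ) (hk : k ≤ n)
    (last : Fin n) (x : Fin k → ℝ) (i j : Fin n) : ℝ :=
  Function.extend (Fin.castLE hk) (fun a => x a / uRow Z η₀ γ₀ (Fin.castLE hk a)) 0 i
    + if last = j then (∑ a, x a) / uCol Z η₀ γ₀ last else 0

lemma sum_extend_mul (hk : k ≤ n) (f : Fin k → ℝ) (g : Fin n → ℝ) :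
    ∑ i, Function.extend (Fin.castLE hk) f 0 i * g i = ∑ a, f a * g (Fin.castLE hk a) := by
  symm
  refine Fintype.sum_of_injective _ (Fin.castLE_injective hk) _ _ (fun i hi => ?_) fun a => ?_
  · rw [Function.extend_apply' _ _ _ hi]; simp
  · rw [(Fin.castLE_injective hk).extend_apply]

lemma sum_linWeight_mul (hk : k ≤ n) (last : Fin n) (x : Fin k → ℝ) (X : Fin n → Fin n → ℝ) :
    ∑ i, ∑ j, linWeight Z η₀ γ₀ hk last x i j * X i j
      = ∑ a, x a * ((∑ j, X (Fin.castLE hk a) j) / uRow Z η₀ γ₀ (Fin.castLE hk a)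
        + (∑ i, X i last) / uCol Z η₀ γ₀ last) := by
  simp only [linWeight, add_mul, Finset.sum_add_distrib, ← Finset.mul_sum, sum_extend_mul,
    ite_mul, zero_mul, Finset.sum_ite_eq, Finset.mem_univ, if_true, mul_add, ← Finset.sum_mul]
  congr 1
  · exact Finset.sum_congr rfl fun a _ => by ring
  · ring

/-- The variance of the linear approximation exceeds the form of S only through the pairs (a, n),
which enter both the row sum of a and the last column sum. -/
lemma sum_linWeight_sq_mul (h : Regular Z η₀ γ₀ B M κ) {last : Fin n}
    (hlast : (last : ℕ) = n - 1) (hk : k ≤ n) (x : Fin k → ℝ) :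
    ∑ i, ∑ j, linWeight Z η₀ γ₀ hk last x i j ^ 2 * u Z η₀ γ₀ i j
      = x ⬝ᵥ (upperLeft k (S Z η₀ γ₀) *ᵥ x)
        + 2 * ∑ a, x a * ((∑ b, x b) * (u Z η₀ γ₀ (Fin.castLE hk a) last
          / (uRow Z η₀ γ₀ (Fin.castLE hk a) * uCol Z η₀ γ₀ last))) := by
  -- Splitting off one factor allows `sum_linWeight_mul` to be applied to the array of weights times
  -- u.
  have h1 : ∀ i j, linWeight Z η₀ γ₀ hk last x i j ^ 2 * u Z η₀ γ₀ i j
      = linWeight Z η₀ γ₀ hk last x i j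
        * (linWeight Z η₀ γ₀ hk last x i j * u Z η₀ γ₀ i j) := fun i j => by ring
  simp only [h1, sum_linWeight_mul]
  have h2 : ∀ a : Fin k, ∑ j, linWeight Z η₀ γ₀ hk last x (Fin.castLE hk a) j
        * u Z η₀ γ₀ (Fin.castLE hk a) j
      = x a + (∑ b, x b) / uCol Z η₀ γ₀ last * u Z η₀ γ₀ (Fin.castLE hk a) last := fun a => by
    simp only [linWeight, (Fin.castLE_injective hk).extend_apply, add_mul,
      Finset.sum_add_distrib, ← Finset.mul_sum, ite_mul, zero_mul, Finset.sum_ite_eq,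
      Finset.mem_univ, if_true]
    congr 1
    exact div_mul_cancel₀ _ (h.uRow_pos _).ne'
  have h3 : ∑ i, linWeight Z η₀ γ₀ hk last x i last * u Z η₀ γ₀ i last
      = ∑ a, x a / uRow Z η₀ γ₀ (Fin.castLE hk a) * u Z η₀ γ₀ (Fin.castLE hk a) last
        + ∑ b, x b := by
    simp only [linWeight, if_true, add_mul, Finset.sum_add_distrib, sum_extend_mul,
      ← Finset.mul_sum]
    congr 1
    exact div_mul_cancel₀ _ (h.uCol_pos _).ne'
  simp only [h2, h3, dotProduct_upperLeft_S_mulVec hlast hk, mul_add, Finset.sum_add_distrib,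
    ← Finset.sum_mul]
  set s := ∑ b, x b
  set U := uCol Z η₀ γ₀ last
  have h4 : ∑ a, x a * ((x a + s / U * u Z η₀ γ₀ (Fin.castLE hk a) last)
        / uRow Z η₀ γ₀ (Fin.castLE hk a))
      = ∑ a, x a ^ 2 / uRow Z η₀ γ₀ (Fin.castLE hk a)
        + ∑ a, x a * (s * (u Z η₀ γ₀ (Fin.castLE hk a) last
          / (uRow Z η₀ γ₀ (Fin.castLE hk a) * U))) := by
    rw [← Finset.sum_add_distrib]
    refine Finset.sum_congr rfl fun a _ => ?_
    have := (h.uRow_pos (Fin.castLE hk a)).ne'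
    have : U ≠ 0 := (h.uCol_pos last).ne'
    field_simp
  have h5 : s * ((∑ a, x a / uRow Z η₀ γ₀ (Fin.castLE hk a) * u Z η₀ γ₀ (Fin.castLE hk a) last
        + s) / U)
      = s ^ 2 / U + ∑ a, x a * (s * (u Z η₀ γ₀ (Fin.castLE hk a) last
          / (uRow Z η₀ γ₀ (Fin.castLE hk a) * U))) := by
    rw [add_div, mul_add, add_comm]
    congr 1
    · ring
    · rw [Finset.sum_div, Finset.mul_sum]
      refine Finset.sum_congr rfl fun a _ => ?_
      have := (h.uRow_pos (Fin.castLE hk a)).ne'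
      have : U ≠ 0 := (h.uCol_pos last).ne'
      field_simp
  rw [h4, h5]
  ring

namespace Regular

/-- The cross term has coefficients of order (B/n)², whereas the coordinates of x sum to at most
kN√n in absolute value. -/
lemma abs_sum_linWeight_sq_mul_sub_le (h : Regular Z η₀ γ₀ B M κ) {last : Fin n}
    (hlast : (last : ℕ) = n - 1) (hk : k ≤ n) {x : Fin k → ℝ} {N : ℝ} (hN : 0 ≤ N)
    (hx : x ⬝ᵥ (upperLeft k (S Z η₀ γ₀) *ᵥ x) = N ^ 2) :
    |∑ i, ∑ j, linWeight Z η₀ γ₀ hk last x i j ^ 2 * u Z η₀ γ₀ i j - N ^ 2|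
      ≤ 2 * (k * N * (B / √n)) ^ 2 := by
  have hB := h.B_pos
  have hn := h.n_pos
  rw [sum_linWeight_sq_mul h hlast hk, hx, add_sub_cancel_left, abs_mul, abs_two]
  refine mul_le_mul_of_nonneg_left ?_ (by norm_num)
  set T := ∑ a, |x a| with hT
  have hT1 : T ≤ k * N * √n := h.sum_abs_le hk hN hx
  have hT0 : 0 ≤ T := Finset.sum_nonneg fun a _ => abs_nonneg _
  have hs : |∑ b, x b| ≤ T := Finset.abs_sum_le_sum_abs _ _
  have hu : ∀ i, |u Z η₀ γ₀ i last / (uRow Z η₀ γ₀ i * uCol Z η₀ γ₀ last)| ≤ (B / n) ^ 2 :=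
    fun i => by
    have h1 := h.abs_u_div_le (h.uRow_ge i) i last
    have h2 := h.uCol_ge last
    have h2p := h.uCol_pos last
    rw [← div_div, abs_div, abs_of_pos h2p, div_le_iff₀ h2p]
    refine h1.trans ?_
    calc B / (2 * n) = (B / n) ^ 2 * (n / (2 * B)) := by field_simp
      _ ≤ _ := by gcongr
  calc _ ≤ ∑ a, |x a| * (T * (B / n) ^ 2) := by
        refine (Finset.abs_sum_le_sum_abs _ _).trans (Finset.sum_le_sum fun a _ => ?_)
        rw [abs_mul, abs_mul]
        have := hu (Fin.castLE hk a)
        gcongr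
    _ = T ^ 2 * (B / n) ^ 2 := by rw [← Finset.sum_mul]; ring
    _ ≤ (k * N * √n) ^ 2 * (B / n) ^ 2 := by gcongr
    _ = (k * N * (B / √n)) ^ 2 := by
      rw [← mul_pow]
      congr 1
      have := Real.mul_self_sqrt hn.le
      have hp : 0 < √(n : ℝ) := Real.sqrt_pos.2 hn
      field_simp
      linear_combination k * N * this

/-- The uniform smallness of the weights required by `IsModel.norm_charFun_sub_le`. -/
lemma abs_linWeight_le (h : Regular Z η₀ γ₀ B M κ) (hk : k ≤ n) (last : Fin n) {x : Fin k → ℝ}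
    {N : ℝ} (hN : 0 ≤ N) (hx : x ⬝ᵥ (upperLeft k (S Z η₀ γ₀) *ᵥ x) = N ^ 2) (i j : Fin n) :
    |linWeight Z η₀ γ₀ hk last x i j| ≤ 4 * (k * N * (B / √n)) := by
  have hB := h.B_pos
  have hn := h.n_pos
  set T := ∑ a, |x a| with hT
  have hT1 : T ≤ k * N * √n := h.sum_abs_le hk hN hx
  have hT0 : 0 ≤ T := Finset.sum_nonneg fun a _ => abs_nonneg _
  have hs : |∑ b, x b| ≤ T := Finset.abs_sum_le_sum_abs _ _
  have hdiv : ∀ {y U : ℝ}, |y| ≤ T → n / (2 * B) ≤ U → |y / U| ≤ T * (2 * B / n) := by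
    intro y U hy hU
    have hU0 : 0 < U := lt_of_lt_of_le (by positivity) hU
    rw [abs_div, abs_of_pos hU0, div_le_iff₀ hU0]
    calc |y| ≤ T := hy
      _ = T * (2 * B / n) * (n / (2 * B)) := by field_simp
      _ ≤ _ := by gcongr
  have h0 : 0 ≤ T * (2 * B / n) := by positivity
  have h1 : |Function.extend (Fin.castLE hk) (fun a => x a / uRow Z η₀ γ₀ (Fin.castLE hk a)) 0 i|
      ≤ T * (2 * B / n) := by
    by_cases hi : ∃ a, Fin.castLE hk a = i
    · obtain ⟨a, rfl⟩ := hi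
      rw [(Fin.castLE_injective hk).extend_apply]
      exact hdiv (Finset.single_le_sum (f := fun a => |x a|) (fun b _ => abs_nonneg _)
        (Finset.mem_univ a)) (h.uRow_ge _)
    · rw [Function.extend_apply' _ _ _ hi]
      simpa using h0
  have h2 : |if last = j then (∑ a, x a) / uCol Z η₀ γ₀ last else 0| ≤ T * (2 * B / n) := by
    split_ifs
    · exact hdiv hs (h.uCol_ge _)
    · simpa using h0
  unfold linWeight
  calc _ ≤ T * (2 * B / n) + T * (2 * B / n) := (abs_add_le _ _).trans (add_le_add h1 h2)
    _ ≤ k * N * √n * (2 * B / n) + k * N * √n * (2 * B / n) := by gcongr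
    _ = _ := by
      have := Real.mul_self_sqrt hn.le
      have hp : 0 < √(n : ℝ) := Real.sqrt_pos.2 hn
      field_simp
      linear_combination 4 * k * N * this

end Regular

/-! ### Comparison of characteristic functions -/

section Compare

variable {Ω : Type*} [MeasurableSpace Ω] {P : Measure Ω} [IsProbabilityMeasure P]

lemma norm_exp_mul_I_sub_exp_mul_I_le (x y : ℝ) :
    ‖Complex.exp (x * Complex.I) - Complex.exp (y * Complex.I)‖ ≤ |x - y| := by
  have h1 : Complex.exp (x * Complex.I) - Complex.exp (y * Complex.I)
      = Complex.exp (y * Complex.I) * (Complex.exp (Complex.I * ((x - y : ℝ) : ℂ)) - 1) := by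
    rw [mul_sub, ← Complex.exp_add, mul_one]
    congr 2
    push_cast
    ring
  rw [h1, norm_mul, Complex.norm_exp_ofReal_mul_I, one_mul]
  exact Real.norm_exp_I_mul_ofReal_sub_one_le

/-- Two random variables that are close off a small event have close characteristic functions. -/
lemma norm_integral_exp_sub_le {Y Y' : Ω → ℝ} (hY : Measurable Y) (hY' : Measurable Y')
    {s : Set Ω} (hs : MeasurableSet s) {D : ℝ} (hD : 0 ≤ D)
    (h : ∀ ω ∉ s, |Y ω - Y' ω| ≤ D) :
    ‖∫ ω, Complex.exp (Y ω * Complex.I) ∂P - ∫ ω, Complex.exp (Y' ω * Complex.I) ∂P‖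
      ≤ D + 2 * P.real s := by
  have hint : ∀ {Y : Ω → ℝ}, Measurable Y → Integrable (fun ω => Complex.exp (Y ω * Complex.I)) P :=
    fun {Y} hY => Integrable.of_bound (by fun_prop) 1
      (ae_of_all _ fun ω => by rw [Complex.norm_exp_ofReal_mul_I])
  rw [← integral_sub (hint hY) (hint hY')]
  refine (norm_integral_le_integral_norm _).trans ?_
  have h1 : ∫ ω, (D + s.indicator (fun _ => (2 : ℝ)) ω) ∂P = D + 2 * P.real s := by
    rw [integral_add (integrable_const _) ((integrable_const _).indicator hs),
      integral_indicator_const _ hs]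
    simp [mul_comm]
  rw [← h1]
  refine integral_mono ((hint hY).sub (hint hY')).norm
    ((integrable_const _).add ((integrable_const _).indicator hs)) fun ω => ?_
  dsimp only
  by_cases hω : ω ∈ s
  · rw [Set.indicator_of_mem hω]
    refine (norm_sub_le _ _).trans ?_
    rw [Complex.norm_exp_ofReal_mul_I, Complex.norm_exp_ofReal_mul_I]
    linarith
  · rw [Set.indicator_of_notMem hω, add_zero]
    exact (norm_exp_mul_I_sub_exp_mul_I_le _ _).trans (h ω hω)

lemma norm_exp_neg_sub_exp_neg_le {x y : ℝ} (hx : 0 ≤ x) (hy : 0 ≤ y) :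
    ‖Complex.exp ((-x : ℝ) : ℂ) - Complex.exp ((-y : ℝ) : ℂ)‖ ≤ |x - y| := by
  rw [← Complex.ofReal_exp, ← Complex.ofReal_exp, ← Complex.ofReal_sub, Complex.norm_real,
    Real.norm_eq_abs]
  wlog hxy : x ≤ y generalizing x y
  · rw [abs_sub_comm, abs_sub_comm x]
    exact this hy hx (le_of_not_ge hxy)
  have h1 : Real.exp (-y) ≤ Real.exp (-x) := Real.exp_le_exp.2 (by linarith)
  rw [abs_of_nonneg (by linarith), abs_of_nonpos (by linarith)]
  have h2 : Real.exp (-y) = Real.exp (-x) * Real.exp (-(y - x)) := by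
    rw [← Real.exp_add]; congr 1; ring
  have h3 := Real.one_sub_le_exp_neg (y - x)
  have h4 : Real.exp (-x) ≤ 1 := Real.exp_le_one_iff.2 (by linarith)
  have h5 := Real.exp_pos (-x)
  rw [h2]
  nlinarith

end Compare

end

/-! ### Distance to the normal law for fixed n, and its rate -/

noncomputable section

variable {n p k : ℕ} {Ω : Type*} [MeasurableSpace Ω] {P : Measure Ω}
  {A : Ω → Adj n} {Z : Fin n → Fin n → Fin p → ℝ} {η₀ : Idx n → ℝ} {γ₀ : Fin p → ℝ}
  {B M κ : ℝ}

/-- Graphs form a finite discrete space, so an arbitrary estimator that is a function of the graph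
is measurable. -/
lemma measurable_comp_adj (hA : IsModel P A Z η₀ γ₀) {E : Type*} [MeasurableSpace E]
    (f : Adj n → E) : Measurable fun ω => f (A ω) :=
  (Measurable.of_discrete (f := f)).comp hA.measurable

/-- Distance of the characteristic function of the standardized estimate from that of the
standard normal law. -/
theorem Regular.norm_charFun_estimate_sub_le [IsProbabilityMeasure P] (h : Regular Z η₀ γ₀ B M κ)
    (hA : IsModel P A Z η₀ γ₀) (hk : k ≤ n) {s r Λ err : ℝ} (hs : s = √(Real.log n))
    (hΛ : Λ = 10 * p * M ^ 2 * κ * B ^ 2)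
    (hr_def : r = 2 * (2 * (2 * B * s / √n) + Λ * (B ^ 2 * s / n)))
    (hr : (2 + p * M) * r ≤ 1) (hrΛ : Λ * (2 * (2 + p * M) ^ 2 * r) ≤ 1 / 2)
    (herr : err = Λ * (B ^ 2 * s / n) + Λ * (2 * (2 + p * M) ^ 2 * r) * r)
    {ηhat : Adj n → Idx n → ℝ} {γhat : Adj n → Fin p → ℝ}
    (hMLE : ∀ a, (∃ η γ, IsMLE Z a η γ) → IsMLE Z a (ηhat a) (γhat a))
    (t : EuclideanSpace ℝ (Fin k)) (ht : 4 * (k * ‖t‖ * (B / √n)) ≤ 1) :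
    ‖charFun (P.map fun ω => (WithLp.toLp 2 ((CFC.sqrt (upperLeft k (S Z η₀ γ₀)))⁻¹ *ᵥ
          firstCoords k (ηhat (A ω) - η₀)) : EuclideanSpace ℝ (Fin k))) t
        - Complex.exp (-‖t‖ ^ 2 / 2)‖
      ≤ k * ‖t‖ * (√n * err) + 2 * ((4 * n + p) * (2 * Real.exp (-2 * Real.log n)))
        + 2 * (4 * (k * ‖t‖ * (B / √n))) * (‖t‖ ^ 2 + 2 * (k * ‖t‖ * (B / √n)) ^ 2)
        + (k * ‖t‖ * (B / √n)) ^ 2 := by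
  have hn4 := h.four_le
  have hn := h.n_pos
  have hB := h.B_pos
  have hM := h.M_ge
  have hκ := h.kappa_pos
  have hs0 : 0 ≤ s := by rw [hs]; positivity
  have hΛ0 : 0 ≤ Λ := by rw [hΛ]; positivity
  have hr0 : 0 ≤ r := by rw [hr_def]; positivity
  have herr0 : 0 ≤ err := by rw [herr]; positivity
  let last : Fin n := ⟨n - 1, by omega⟩
  have hlast : (last : ℕ) = n - 1 := rfl
  set C := upperLeft k (S Z η₀ γ₀) with hC
  -- Moving the symmetric matrix C^{-1/2} onto t reduces the vector statement to the scalar v·(η̂ -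
  -- η) with variance form ‖t‖².
  set v : Fin k → ℝ := (CFC.sqrt C)⁻¹ *ᵥ t.ofLp with hv
  have hvq : v ⬝ᵥ (C *ᵥ v) = ‖t‖ ^ 2 := by
    rw [hv, dotProduct_mulVec_inv_sqrt (h.posDef_upperLeft_S hk), ← real_inner_self_eq_norm_sq,
      EuclideanSpace.inner_eq_star_dotProduct, star_trivial]
  have hT := h.sum_abs_le hk (norm_nonneg t) hvq
  let Y : Ω → ℝ := fun ω => v ⬝ᵥ firstCoords k (ηhat (A ω) - η₀)
  let Y' : Ω → ℝ := fun ω => ∑ i, ∑ j, linWeight Z η₀ γ₀ hk last v i j * resid Z (A ω) η₀ γ₀ i j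
  have hY : Measurable Y :=
    measurable_comp_adj hA fun a => v ⬝ᵥ firstCoords k (ηhat a - η₀)
  have hY' : Measurable Y' := measurable_comp_adj hA fun a =>
    ∑ i, ∑ j, linWeight Z η₀ γ₀ hk last v i j * resid Z a η₀ γ₀ i j
  have hchar : charFun (P.map fun ω => (WithLp.toLp 2 ((CFC.sqrt C)⁻¹ *ᵥ
      firstCoords k (ηhat (A ω) - η₀)) : EuclideanSpace ℝ (Fin k))) t
      = ∫ ω, Complex.exp (Y ω * Complex.I) ∂P := by
    rw [charFun_apply, integral_map]
    · refine integral_congr_ae (ae_of_all _ fun ω => ?_)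
      dsimp only
      rw [EuclideanSpace.inner_eq_star_dotProduct, star_trivial, dotProduct_inv_sqrt_mulVec]
    · exact (measurable_comp_adj hA fun a => (WithLp.toLp 2 ((CFC.sqrt C)⁻¹ *ᵥ
        firstCoords k (ηhat a - η₀)) : EuclideanSpace ℝ (Fin k))).aemeasurable
    · fun_prop
  let good : Adj n → Prop := fun a => (∃ η γ, IsMLE Z a η γ) ∧ ∀ η γ, IsMLE Z a η γ → ∀ i,
      |η (Sum.inl i) - η₀ (Sum.inl i) - ((∑ j, resid Z a η₀ γ₀ i j) / uRow Z η₀ γ₀ i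
          + (∑ k, resid Z a η₀ γ₀ k last) / uCol Z η₀ γ₀ last)|
        ≤ Λ * (B ^ 2 * s / n) + Λ * (2 * (2 + p * M) ^ 2 * r) * r
  have hbad : P.real {ω | ¬ good (A ω)} ≤ (4 * n + p) * (2 * Real.exp (-2 * Real.log n)) :=
    h.measure_bad_le hA hlast hs hΛ hr_def hr hrΛ
  have hmeas : MeasurableSet {ω | ¬ good (A ω)} :=
    hA.measurable (MeasurableSet.of_discrete (s := {a | ¬ good a}))
  have hclose : ∀ ω ∉ {ω | ¬ good (A ω)}, |Y ω - Y' ω| ≤ k * ‖t‖ * (√n * err) := by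
    intro ω hω
    have hg : good (A ω) := not_not.1 hω
    have h1 := hg.2 _ _ (hMLE _ hg.1)
    have h2 : Y ω - Y' ω = ∑ a, v a * (ηhat (A ω) (Sum.inl (Fin.castLE hk a))
        - η₀ (Sum.inl (Fin.castLE hk a))
        - ((∑ j, resid Z (A ω) η₀ γ₀ (Fin.castLE hk a) j) / uRow Z η₀ γ₀ (Fin.castLE hk a)
          + (∑ k, resid Z (A ω) η₀ γ₀ k last) / uCol Z η₀ γ₀ last)) := by
      simp only [Y, Y', sum_linWeight_mul, dotProduct, firstCoords, dif_pos hk, Pi.sub_apply,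
        ← Finset.sum_sub_distrib]
      exact Finset.sum_congr rfl fun a _ => by ring
    rw [h2]
    calc _ ≤ ∑ a, |v a| * err := by
          refine (Finset.abs_sum_le_sum_abs _ _).trans (Finset.sum_le_sum fun a _ => ?_)
          rw [abs_mul, herr]
          exact mul_le_mul_of_nonneg_left (h1 _) (abs_nonneg _)
      _ ≤ k * ‖t‖ * √n * err := by
          rw [← Finset.sum_mul]
          exact mul_le_mul_of_nonneg_right hT herr0
      _ = _ := by ring
  have b1 := norm_integral_exp_sub_le (P := P) hY hY' hmeas (by positivity) hclose
  have b2 := hA.norm_charFun_sub_le (c := linWeight Z η₀ γ₀ hk last v)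
    (fun i j _ => h.abs_linWeight_le hk last (norm_nonneg t) hvq i j) ht
  have b3 := h.abs_sum_linWeight_sq_mul_sub_le hlast hk (norm_nonneg t) hvq
  set W := ∑ i, ∑ j, linWeight Z η₀ γ₀ hk last v i j ^ 2 * u Z η₀ γ₀ i j with hW
  have hW0 : 0 ≤ W := Finset.sum_nonneg fun i _ => Finset.sum_nonneg fun j _ =>
    mul_nonneg (sq_nonneg _) (u_nonneg i j)
  have hWle : W ≤ ‖t‖ ^ 2 + 2 * (k * ‖t‖ * (B / √n)) ^ 2 := by
    linarith [le_abs_self (W - ‖t‖ ^ 2)]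
  have b4 := norm_exp_neg_sub_exp_neg_le (x := W / 2) (y := ‖t‖ ^ 2 / 2) (by positivity)
    (by positivity)
  have b5 : |W / 2 - ‖t‖ ^ 2 / 2| ≤ (k * ‖t‖ * (B / √n)) ^ 2 := by
    rw [← sub_div, abs_div, abs_two]; linarith
  have b6 : 2 * (4 * (k * ‖t‖ * (B / √n))) * W
      ≤ 2 * (4 * (k * ‖t‖ * (B / √n))) * (‖t‖ ^ 2 + 2 * (k * ‖t‖ * (B / √n)) ^ 2) := by
    gcongr
  have e1 : (-W / 2 : ℝ) = -(W / 2) := by ring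
  have e2 : Complex.exp (-(‖t‖ : ℂ) ^ 2 / 2) = Complex.exp ((-(‖t‖ ^ 2 / 2) : ℝ) : ℂ) := by
    congr 1; push_cast; ring
  rw [e1] at b2
  rw [hchar, e2]
  -- Three comparisons: estimate with linear statistic, linear statistic with a Gaussian of variance
  -- W, and W with ‖t‖². On the exceptional event the estimate is arbitrary, but exponentials there
  -- differ by at most 2.
  refine (norm_sub_le_norm_sub_add_norm_sub _ (∫ ω, Complex.exp (Y' ω * Complex.I) ∂P) _).trans ?_
  refine (add_le_add b1 (norm_sub_le_norm_sub_add_norm_sub _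
    (Complex.exp ((-(W / 2) : ℝ) : ℂ)) _)).trans ?_
  have b7 := add_le_add (b2.trans b6) (b4.trans b5)
  linarith

/-- All error terms are controlled by the single rate `κ B⁴ log n / √n`. -/
lemma Regular.rate_bounds (h : Regular Z η₀ γ₀ B M κ) {s r Λ E : ℝ} (hs : s = √(Real.log n))
    (hlog : 1 ≤ Real.log n) (hΛ : Λ = 10 * p * M ^ 2 * κ * B ^ 2)
    (hr : r = 2 * (2 * (2 * B * s / √n) + Λ * (B ^ 2 * s / n)))
    (hE : E = κ * B ^ 4 * Real.log n / √n) :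
    B / √n ≤ 2 * p * M ^ 2 * E ∧
    Λ * r ≤ 10 * p * M ^ 2 * (E * (8 + 2 * (10 * p * M ^ 2) * E)) ∧
    r ≤ 2 * p * M ^ 2 * (E * (8 + 2 * (10 * p * M ^ 2) * E)) ∧
    √n * (Λ * (B ^ 2 * s / n) + Λ * (2 * (2 + p * M) ^ 2 * r) * r)
      ≤ 10 * p * M ^ 2 * E + 10 * p * M ^ 2 * (2 * (2 + p * M) ^ 2)
        * (E * (8 + 2 * (10 * p * M ^ 2) * E) ^ 2) := by
  have hn := h.n_pos
  have hB4 := h.B_ge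
  have hB := h.B_pos
  have hM := h.M_ge
  have hκ := h.kappa_pos
  have hone := h.one_le_kappa_mul
  set q := √(n : ℝ) with hq
  have hq0 : 0 < q := Real.sqrt_pos.2 hn
  have hqn : (n : ℝ) = q ^ 2 := (Real.sq_sqrt hn.le).symm
  have hs1 : 1 ≤ s := by rw [hs]; exact Real.one_le_sqrt.2 hlog
  have hL : Real.log n = s ^ 2 := by rw [hs, Real.sq_sqrt (by linarith)]
  rw [hL] at hE
  set K := 10 * p * M ^ 2 with hK
  have hK0 : 0 ≤ K := by positivity
  have hE0 : 0 ≤ E := by rw [hE]; positivity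
  have hB1 : 1 ≤ B := by linarith
  have hBs : 1 ≤ B * s ^ 2 := by nlinarith
  have h1 : κ * B ^ 3 / q ≤ E := by
    rw [hE]
    refine div_le_div_of_nonneg_right ?_ hq0.le
    nlinarith [mul_le_mul_of_nonneg_left hBs (by positivity : 0 ≤ κ * B ^ 3)]
  have h2 : κ * B ^ 2 * (B * s / q) ≤ E := by
    rw [hE, ← mul_div_assoc]
    refine div_le_div_of_nonneg_right ?_ hq0.le
    have : 1 ≤ B * s := by nlinarith
    nlinarith [mul_le_mul_of_nonneg_left this (by positivity : 0 ≤ κ * B ^ 3 * s)]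
  have h3 : κ * B ^ 4 * s / q ≤ E := by
    rw [hE]
    gcongr
    nlinarith
  have hrx : r ≤ B * s / q * (8 + 2 * K * E) := by
    have e : r = B * s / q * (8 + 2 * K * (κ * B ^ 3 / q)) := by
      rw [hr, hΛ, hqn]
      field_simp
      ring
    rw [e]
    gcongr
  have hr0 : 0 ≤ r := by rw [hr, hΛ]; positivity
  set x := B * s / q with hx
  have hx0 : 0 ≤ x := by positivity
  have h4 : κ * B ^ 2 * r ≤ E * (8 + 2 * K * E) := by
    calc κ * B ^ 2 * r ≤ κ * B ^ 2 * (x * (8 + 2 * K * E)) := by gcongr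
      _ = κ * B ^ 2 * x * (8 + 2 * K * E) := by ring
      _ ≤ _ := by gcongr
  refine ⟨?_, ?_, ?_, ?_⟩
  -- Neither B/√n nor r contains κ; `one_le_kappa_mul` supplies it at the cost of a factor 2pM²B.
  · calc B / q = B / q * 1 := by ring
      _ ≤ B / q * (κ * (2 * p * M ^ 2 * B)) := by gcongr
      _ = 2 * p * M ^ 2 * (κ * B ^ 2 / q) := by ring
      _ ≤ 2 * p * M ^ 2 * (κ * B ^ 3 / q) := by
        gcongr
        norm_num
      _ ≤ _ := by gcongr
  · calc Λ * r = K * (κ * B ^ 2 * r) := by rw [hΛ]; ring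
      _ ≤ _ := by gcongr
  · calc r = r * 1 := by ring
      _ ≤ r * (κ * (2 * p * M ^ 2 * B)) := by gcongr
      _ = 2 * p * M ^ 2 * (κ * B ^ 1 * r) := by ring
      _ ≤ 2 * p * M ^ 2 * (κ * B ^ 2 * r) := by
        gcongr
        norm_num
      _ ≤ _ := by gcongr
  · rw [mul_add]
    refine add_le_add ?_ ?_
    · calc q * (Λ * (B ^ 2 * s / n)) = K * (κ * B ^ 4 * s / q) := by
            rw [hΛ, hqn]; field_simp
        _ ≤ _ := by gcongr
    · calc q * (Λ * (2 * (2 + p * M) ^ 2 * r) * r)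
          = K * (2 * (2 + p * M) ^ 2) * (q * (κ * B ^ 2) * r ^ 2) := by rw [hΛ]; ring
        _ ≤ K * (2 * (2 + p * M) ^ 2) * (q * (κ * B ^ 2) * (x * (8 + 2 * K * E)) ^ 2) := by gcongr
        _ = K * (2 * (2 + p * M) ^ 2) * (E * (8 + 2 * K * E) ^ 2) := by
          -- The quadratic remainder is the critical term: it determines the form of E.
          have : q * (κ * B ^ 2) * x ^ 2 = E := by
            rw [hx, hE]; field_simp
          rw [mul_pow, ← mul_assoc (q * (κ * B ^ 2)), this]

/-- The centre of the balls is admissible in the supremum. The work lies in boundedness, without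
which `sSup` would take a default value; it holds because predictors are bounded on bounded
parameter sets. -/
lemma inv_muDeriv_le_bn {ε₁ ε₂ : ℝ} (hε₁ : 0 ≤ ε₁) (hε₂ : 0 ≤ ε₂)
    (hZ : ∀ i j, i ≠ j → ∀ l, |Z i j l| ≤ M) {i j : Fin n} (hij : i ≠ j) :
    (muDeriv (linPred Z η₀ γ₀ i j))⁻¹ ≤ bn Z η₀ γ₀ ε₁ ε₂ := by
  have hbdd : BddAbove {x : ℝ | ∃ η ∈ Metric.closedBall η₀ ε₁, ∃ γ ∈ Metric.closedBall γ₀ ε₂,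
      ∃ i j : Fin n, i ≠ j ∧
        x = (1 + Real.exp (linPred Z η γ i j)) ^ 2 / Real.exp (linPred Z η γ i j)} := by
    set R := 2 * (‖η₀‖ + ε₁) + |p * M| * (‖γ₀‖ + ε₂)
    refine ⟨Real.exp R + 2 + Real.exp R, ?_⟩
    rintro x ⟨η, hη, γ, hγ, i, j, hij, rfl⟩
    have h1 : ‖η‖ ≤ ‖η₀‖ + ε₁ := norm_le_of_mem_closedBall hη
    have h2 : ‖γ‖ ≤ ‖γ₀‖ + ε₂ := norm_le_of_mem_closedBall hγ
    have h3 : |linPred Z η γ i j| ≤ R := by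
      refine (abs_add_three _ _ _).trans ?_
      have e1 := abs_alpha_le η i
      have e2 := abs_beta_le η j
      have e3 := abs_dotProduct_le (y := γ) (hZ i j hij)
      have e4 : p * M * ‖γ‖ ≤ |p * M| * (‖γ₀‖ + ε₂) :=
        mul_le_mul (le_abs_self _) h2 (norm_nonneg _) (abs_nonneg _)
      simp only [R]
      linarith
    have h4 : (1 + Real.exp (linPred Z η γ i j)) ^ 2 / Real.exp (linPred Z η γ i j)
        = Real.exp (linPred Z η γ i j) + 2 + Real.exp (-linPred Z η γ i j) := by
      rw [← inv_inv (Real.exp _ + 2 + _), ← muDeriv_eq, muDeriv, inv_div]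
    rw [h4]
    rw [abs_le] at h3
    gcongr
    · exact h3.2
    · linarith [h3.1]
  refine le_csSup hbdd ⟨η₀, Metric.mem_closedBall_self hε₁, γ₀, Metric.mem_closedBall_self hε₂, i,
    j, hij, ?_⟩
  rw [muDeriv, inv_div]

end

/-! ### Passage to the limit -/

lemma tendsto_bad_bound (p : ℕ) :
    Tendsto (fun n : ℕ => (4 * (n : ℝ) + p) * (2 * Real.exp (-2 * Real.log n))) atTop (𝓝 0) := by
  have h1 : Tendsto (fun n : ℕ => 8 * (n : ℝ)⁻¹ + 2 * p * ((n : ℝ)⁻¹ * (n : ℝ)⁻¹)) atTop (𝓝 0) := by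
    have h0 := tendsto_inv_atTop_nhds_zero_nat (𝕜 := ℝ)
    simpa using (h0.const_mul 8).add ((h0.mul h0).const_mul (2 * (p : ℝ)))
  refine h1.congr' ?_
  filter_upwards [eventually_ge_atTop 1] with n hn
  have hn' : (0 : ℝ) < n := by exact_mod_cast hn
  have : Real.exp (-2 * Real.log n) = ((n : ℝ) ^ 2)⁻¹ := by
    rw [neg_mul, Real.exp_neg, mul_comm, Real.exp_mul, Real.exp_log hn']
    norm_num
  rw [this]
  field_simp
  ring

lemma eventually_regular {p : ℕ} (hp : 1 ≤ p)
    {Z : ∀ n : ℕ, Fin n → Fin n → Fin p → ℝ} {M : ℝ} (hM : 1 ≤ M)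
    (hZ : ∀ n (i j : Fin n), i ≠ j → ∀ l, |Z n i j l| ≤ M)
    {η₀ : ∀ n : ℕ, Idx n → ℝ} {γ₀ : ℕ → Fin p → ℝ} {ε₁ ε₂ κ : ℕ → ℝ}
    (hε₁ : ∀ᶠ n in atTop, 0 < ε₁ n) (hε₂ : ∀ᶠ n in atTop, 0 < ε₂ n)
    (hH : ∀ᶠ n : ℕ in atTop, ∀ η ∈ Metric.closedBall (η₀ n) (ε₁ n),
      (H (Z n) η (γ₀ n)).PosDef ∧ infNorm (H (Z n) η (γ₀ n))⁻¹ ≤ κ n / (n : ℝ) ^ 2) :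
    ∀ᶠ n in atTop, Regular (Z n) (η₀ n) (γ₀ n) (bn (Z n) (η₀ n) (γ₀ n) (ε₁ n) (ε₂ n)) M (κ n) := by
  filter_upwards [hε₁, hε₂, hH, eventually_ge_atTop 4] with n h1 h2 h3 h4
  have hb : ∀ {i j : Fin n}, i ≠ j → _ := fun hij =>
    inv_muDeriv_le_bn (η₀ := η₀ n) (γ₀ := γ₀ n) h1.le h2.le (hZ n) hij
  -- Any pair of distinct nodes will do, since μ' ≤ 1/4 everywhere.
  have hB : 4 ≤ bn (Z n) (η₀ n) (γ₀ n) (ε₁ n) (ε₂ n) := by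
    refine le_trans ?_ (hb (i := ⟨0, by omega⟩) (j := ⟨1, by omega⟩) (by simp))
    rw [le_inv_comm₀ (by norm_num) (muDeriv_pos _)]
    refine (muDeriv_le _).trans (by norm_num)
  obtain ⟨h5, h6⟩ := h3 (η₀ n) (Metric.mem_closedBall_self h1.le)
  exact ⟨h4, hp, hB, hM, fun i j hij => by
    rw [u, if_neg hij, one_div]
    exact inv_le_of_inv_le₀ (muDeriv_pos _) (hb hij), hZ n, h5, h6⟩

end CovP0

open CovP0 in
theorem theorem2 {p : ℕ} (hp : 1 ≤ p)
    -- the covariates, with entries in a fixed compact set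
    (Z : ∀ n : ℕ, Fin n → Fin n → Fin p → ℝ)
    (K : Set ℝ) (hK : IsCompact K)
    (hZ : ∀ n (i j : Fin n), i ≠ j → ∀ l, Z n i j l ∈ K)
    -- the true parameters
    (η₀ : ∀ n : ℕ, CovP0.Idx n → ℝ) (γ₀ : ℕ → Fin p → ℝ)
    -- the random graphs
    {Ω : ℕ → Type*} [∀ n, MeasurableSpace (Ω n)]
    (P : ∀ n, Measure (Ω n)) [∀ n, IsProbabilityMeasure (P n)]
    (A : ∀ n, Ω n → CovP0.Adj n)
    (hA : ∀ n, CovP0.IsModel (P n) (A n) (Z n) (η₀ n) (γ₀ n))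
    -- the radii in the definitions of `b_n` and `κ_n`
    (ε₁ ε₂ : ℕ → ℝ)
    (hε₁ : ∀ᶠ n in atTop, 0 < ε₁ n) (hε₁_lim : Tendsto ε₁ atTop (𝓝 0))
    (hε₂ : ∀ᶠ n in atTop, 0 < ε₂ n)
    (hε₂_le : ∀ᶠ n : ℕ in atTop,
      ε₂ n ≤ Real.sqrt (Real.log n / n) / (p * CovP0.zmax (Z n)))
    -- `H` is positive definite near the true parameter, and `κ_n` bounds its inverse
    (κ : ℕ → ℝ)
    (hH : ∀ᶠ n : ℕ in atTop, ∀ η ∈ Metric.closedBall (η₀ n) (ε₁ n),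
      (CovP0.H (Z n) η (γ₀ n)).PosDef ∧
      CovP0.infNorm (CovP0.H (Z n) η (γ₀ n))⁻¹ ≤ κ n / (n : ℝ) ^ 2)
    (hrate : (fun n : ℕ => κ n * CovP0.bn (Z n) (η₀ n) (γ₀ n) (ε₁ n) (ε₂ n) ^ 12)
      =o[atTop] fun n : ℕ => Real.sqrt n / Real.log n)
    -- the estimators: a maximum likelihood estimate whenever one exists
    (ηhat : ∀ n, CovP0.Adj n → CovP0.Idx n → ℝ) (γhat : ∀ n, CovP0.Adj n → Fin p → ℝ)
    (hMLE : ∀ n (a : CovP0.Adj n), (∃ η γ, CovP0.IsMLE (Z n) a η γ) →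
      CovP0.IsMLE (Z n) a (ηhat n a) (γhat n a)) :
    Tendsto (fun n => P n {ω | ∃ η γ, CovP0.IsMLE (Z n) (A n ω) η γ}) atTop (𝓝 1) ∧
    ∀ k : ℕ, 1 ≤ k →
      CovP0.AsympNormal P
        (fun n ω => CovP0.firstCoords k (ηhat n (A n ω) - η₀ n))
        (fun n => CovP0.upperLeft k (CovP0.S (Z n) (η₀ n) (γ₀ n))) := by
  obtain ⟨R, hR⟩ := hK.isBounded.exists_norm_le
  set M := max 1 R
  have hM : 1 ≤ M := le_max_left _ _
  have hZM : ∀ n (i j : Fin n), i ≠ j → ∀ l, |Z n i j l| ≤ M := fun n i j hij l =>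
    (hR _ (hZ n i j hij l)).trans (le_max_right _ _)
  have hreg := eventually_regular hp hM hZM hε₁ hε₂ hH
  set B : ℕ → ℝ := fun n => bn (Z n) (η₀ n) (γ₀ n) (ε₁ n) (ε₂ n)
  let E : ℕ → ℝ := fun n => κ n * B n ^ 4 * Real.log n / √n
  let s : ℕ → ℝ := fun n => √(Real.log n)
  let Λ : ℕ → ℝ := fun n => 10 * p * M ^ 2 * κ n * B n ^ 2
  let r : ℕ → ℝ := fun n => 2 * (2 * (2 * B n * s n / √n) + Λ n * (B n ^ 2 * s n / n))
  let err : ℕ → ℝ := fun n =>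
    Λ n * (B n ^ 2 * s n / n) + Λ n * (2 * (2 + p * M) ^ 2 * r n) * r n
  have hlog : ∀ᶠ n : ℕ in atTop, 1 ≤ Real.log n :=
    (Real.tendsto_log_atTop.comp tendsto_natCast_atTop_atTop).eventually_ge_atTop 1
  have hE : Tendsto E atTop (𝓝 0) := by
    refine squeeze_zero' ?_ ?_ hrate.tendsto_div_nhds_zero
    · filter_upwards [hreg, hlog] with n h hl
      have := h.kappa_pos
      have := h.B_pos
      simp only [E]
      positivity
    · filter_upwards [hreg, hlog] with n h hl
      have h1 := h.kappa_pos
      have h2 : 1 ≤ B n := by linarith [h.B_ge]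
      -- As b_n ≥ 1, the assumed rate dominates E, which involves only the fourth power.
      have h3 : B n ^ 4 ≤ B n ^ 12 := pow_le_pow_right₀ h2 (by norm_num)
      simp only [E]
      rw [div_div_eq_mul_div]
      gcongr
  have hbounds := (hreg.and hlog).mono fun n h =>
    h.1.rate_bounds (s := s n) (r := r n) (Λ := Λ n) (E := E n) rfl h.2 rfl rfl rfl
  have hΛr : ∀ᶠ n in atTop, Λ n * (2 * (2 + p * M) ^ 2 * r n) ≤ 1 / 2 := by
    have h1 : Tendsto (fun n => 2 * (2 + p * M) ^ 2
        * (10 * p * M ^ 2 * (E n * (8 + 2 * (10 * p * M ^ 2) * E n)))) atTop (𝓝 0) := by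
      simpa using ((hE.mul ((hE.const_mul (2 * (10 * p * M ^ 2))).const_add 8)).const_mul
        (10 * p * M ^ 2)).const_mul (2 * (2 + p * M) ^ 2)
    filter_upwards [hbounds, h1.eventually_le_const (by norm_num : (0 : ℝ) < 1 / 2)] with n h h'
    refine le_trans ?_ h'
    calc _ = 2 * (2 + p * M) ^ 2 * (Λ n * r n) := by ring
      _ ≤ _ := mul_le_mul_of_nonneg_left h.2.1 (by positivity)
  have hr1 : ∀ᶠ n in atTop, (2 + p * M) * r n ≤ 1 := by
    have h1 : Tendsto (fun n => (2 + p * M)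
        * (2 * p * M ^ 2 * (E n * (8 + 2 * (10 * p * M ^ 2) * E n)))) atTop (𝓝 0) := by
      simpa using ((hE.mul ((hE.const_mul (2 * (10 * p * M ^ 2))).const_add 8)).const_mul
        (2 * p * M ^ 2)).const_mul (2 + p * M)
    filter_upwards [hbounds, h1.eventually_le_const (by norm_num : (0 : ℝ) < 1)] with n h h'
    exact (mul_le_mul_of_nonneg_left h.2.2.1 (by positivity)).trans h'
  have herr : Tendsto (fun n : ℕ => √n * err n) atTop (𝓝 0) := by
    have h1 : Tendsto (fun n => 10 * p * M ^ 2 * E n + 10 * p * M ^ 2 * (2 * (2 + p * M) ^ 2)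
        * (E n * (8 + 2 * (10 * p * M ^ 2) * E n) ^ 2)) atTop (𝓝 0) := by
      simpa using (hE.const_mul (10 * p * M ^ 2)).add
        ((hE.mul (((hE.const_mul (2 * (10 * p * M ^ 2))).const_add 8).pow 2)).const_mul
          (10 * p * M ^ 2 * (2 * (2 + p * M) ^ 2)))
    refine squeeze_zero' ?_ (hbounds.mono fun n h => h.2.2.2) h1
    filter_upwards [hreg] with n h
    have := h.kappa_pos
    have := h.B_pos
    simp only [err, r, Λ, s]
    positivity
  have hBn : Tendsto (fun n : ℕ => B n / √n) atTop (𝓝 0) := by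
    refine squeeze_zero' ?_ (hbounds.mono fun n h => h.1)
      (by simpa using hE.const_mul (2 * p * M ^ 2))
    filter_upwards [hreg] with n h
    have := h.B_pos
    positivity
  refine ⟨?_, fun k hk => ⟨?_, ?_⟩⟩
  · have h1 : Tendsto (fun n : ℕ => 1 - ENNReal.ofReal
        ((4 * (n : ℝ) + p) * (2 * Real.exp (-2 * Real.log n)))) atTop (𝓝 1) := by
      have h2 := ENNReal.tendsto_ofReal (tendsto_bad_bound p)
      have h3 := ENNReal.Tendsto.sub (tendsto_const_nhds (x := (1 : ENNReal))) h2
        (Or.inl ENNReal.one_ne_top)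
      simpa using h3
    refine tendsto_of_tendsto_of_tendsto_of_le_of_le' h1 tendsto_const_nhds ?_
      (Eventually.of_forall fun n => prob_le_one)
    filter_upwards [hreg, hΛr, hr1] with n h h2 h3
    have hn := h.four_le
    have hbad := h.measure_bad_le (hA n) (last := ⟨n - 1, by omega⟩) rfl (s := s n) (r := r n)
      (Λ := Λ n) rfl rfl rfl h3 h2
    rw [tsub_le_iff_right]
    have hm : MeasurableSet {ω | ∃ η γ, IsMLE (Z n) (A n ω) η γ} :=
      (hA n).measurable (MeasurableSet.of_discrete (s := {a | ∃ η γ, IsMLE (Z n) a η γ}))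
    rw [← prob_add_prob_compl hm (μ := P n)]
    gcongr
    rw [← ofReal_measureReal]
    refine ENNReal.ofReal_le_ofReal (le_trans (measureReal_mono ?_) hbad)
    intro ω hω hgood
    exact hω hgood.1
  · filter_upwards [hreg, eventually_ge_atTop k] with n h hn
    exact h.posDef_upperLeft_S hn
  · have hmeas : ∀ n, Measurable fun ω => (WithLp.toLp 2
        ((CFC.sqrt (upperLeft k (S (Z n) (η₀ n) (γ₀ n))))⁻¹ *ᵥ
          firstCoords k (ηhat n (A n ω) - η₀ n)) : EuclideanSpace ℝ (Fin k)) := fun n =>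
      measurable_comp_adj (hA n) fun a => (WithLp.toLp 2
        ((CFC.sqrt (upperLeft k (S (Z n) (η₀ n) (γ₀ n))))⁻¹ *ᵥ
          firstCoords k (ηhat n a - η₀ n)) : EuclideanSpace ℝ (Fin k))
    refine ⟨fun n => (hmeas n).aemeasurable, aemeasurable_id, ?_⟩
    -- Lévy's continuity theorem reduces convergence in distribution to pointwise convergence at
    -- each fixed t.
    refine ProbabilityMeasure.tendsto_iff_tendsto_charFun.2 fun t => ?_
    simp only [ProbabilityMeasure.coe_mk, Measure.map_id]
    rw [charFun_stdGaussian, tendsto_iff_norm_sub_tendsto_zero]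
    have hkB : Tendsto (fun n : ℕ => k * ‖t‖ * (B n / √n)) atTop (𝓝 0) := by
      simpa using hBn.const_mul (k * ‖t‖)
    have hlim : Tendsto (fun n : ℕ => k * ‖t‖ * (√n * err n)
        + 2 * ((4 * n + p) * (2 * Real.exp (-2 * Real.log n)))
        + 2 * (4 * (k * ‖t‖ * (B n / √n))) * (‖t‖ ^ 2 + 2 * (k * ‖t‖ * (B n / √n)) ^ 2)
        + (k * ‖t‖ * (B n / √n)) ^ 2) atTop (𝓝 0) := by
      have e1 := herr.const_mul (k * ‖t‖)
      have e2 := (tendsto_bad_bound p).const_mul 2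
      have e3 := ((hkB.const_mul 4).const_mul 2).mul
        (((hkB.pow 2).const_mul 2).const_add (‖t‖ ^ 2))
      have e4 := hkB.pow 2
      simpa using ((e1.add e2).add e3).add e4
    have h4 : Tendsto (fun n : ℕ => 4 * (k * ‖t‖ * (B n / √n))) atTop (𝓝 0) := by
      simpa using hkB.const_mul 4
    refine squeeze_zero' (Eventually.of_forall fun n => norm_nonneg _) ?_ hlim
    filter_upwards [hreg, hΛr, hr1, eventually_ge_atTop k,
      h4.eventually_le_const (by norm_num : (0 : ℝ) < 1)] with n h h2 h3 hkn ht
    exact h.norm_charFun_estimate_sub_le (hA n) hkn (s := s n) (r := r n) (Λ := Λ n)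
      (err := err n) rfl rfl rfl h3 h2 rfl (hMLE n) t ht
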